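/- Let $q$ be a power of an odd prime $p$, let $V$ be a finite-dimensional vector space over $GF(q)$ with a nondegenerate symplectic (alternating) form $\varphi$, and let $\mathrm{Sp}(V)$ be its symplectic group, acting on the right by $v\mapsto v^g$; write $V^{g-1}=\{x^g-x : x\in V\}$. Let $K=\mathbb{Q}(e^{2\pi i/p})$, $\psi(\alpha)=e^{(2\pi i/p)\,\mathrm{tr}\,\alpha}$ with $\mathrm{tr}:GF(q)\to GF(p)$ the trace, and $f(x,y)=\psi(\varphi(x,y))$. Let $\mathcal{A}$ be the twisted group algebra of $V$ over $K$: it has $K$-basis $\{(x):x\in V\}$ and multiplication $(x)(y)=f(x,y)(x+y)$. For $g\in\mathrm{Sp}(V)$ let $s(g)$ be the unique invertible element of $\mathcal{A}$ with $(0)$-coefficient $1$ and $s(g)^{-1}(x)s(g)=(x^g)$ for all $x\in V$. For complementary Lagrangian (maximal totally isotropic) subspaces $W,W^*$ of $V$, put $e_0=|W|^{-1}\sum_{w\in W}(w)$ and $e_{ab}=(-a)e_0(b)$ for $a,b\in W^*$. The $e_{ab}$ form a $K$-basis of $\mathcal{A}$ consisting of matrix units; for $\mathfrak a=\sum\alpha_{ab}e_{ab}\in\mathcal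 A$ let $[\mathfrak a]=(\alpha_{ab})_{a,b\in W^*}$ and $\det\mathfrak a=\det[\mathfrak a]$. For a partition $W^*=P\sqcup(-P)\sqcup\{0\}$ let $\mathfrak a^\flat=(\alpha_{a,b}-\alpha_{a,-b})_{a,b\in P}$. Define $$\eta(g)=\bigl(\det s(g)^\flat\bigr)^2\,\bigl(\det s(g)\bigr)^{-1}.$$ Let $\chi$ be the quadratic character of $GF(q)$. Let $W,W^*$ be any complementary Lagrangian subspaces of $V$, let $g\in\mathrm{Sp}(V)$ with $W^g=W$, and let $g^*$ be the linear map on $W^*$ determined by $W+a^{g^*}=W+a^g$ for $a\in W^*$. Then $$\eta(g)=\frac{\chi(\det g^*)}{\displaystyle\sum_{y=x^{g-1}\in W\cap V^{g-1}}f(x^g,x)},$$ where the sum is over $y\in W\cap V^{g-1}$ and, for each such $y$, $x\in V$ is any element with $x^g-x=y$; in particular the denominator is nonzero. The formula holds whichever complementary Lagrangian subspaces and partition were used to compute $\eta(g)$, not necessarily the pair $W,W^*$. -/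

import Mathlib

noncomputable section

set_option linter.unusedSectionVars false

namespace WeilRep

/-- The field `K = ℚ(e^{2πi/p})`, as a subfield of `ℂ`. -/
abbrev CycField (p : ℕ) : IntermediateField ℚ ℂ :=
  IntermediateField.adjoin ℚ {Complex.exp (2 * Real.pi * Complex.I / p)}

/-- The element `e^{2πi/p}` of `K`. -/
def zeta (p : ℕ) : CycField p :=
  ⟨Complex.exp (2 * Real.pi * Complex.I / p), IntermediateField.mem_adjoin_simple_self ℚ _⟩

theorem zeta_isPrimitiveRoot (p : ℕ) [NeZero p] : IsPrimitiveRoot (zeta p) p := by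
  have h := Complex.isPrimitiveRoot_exp p (NeZero.ne p)
  exact IsPrimitiveRoot.of_map_of_injective (f := algebraMap (CycField p) ℂ) h
    (algebraMap (CycField p) ℂ).injective

/-- The canonical additive character `ψ(α) = e^{(2πi/p) tr α}`, where `tr` is the trace
to the prime field. -/
def psi (p : ℕ) [Fact p.Prime] {F : Type*} [Field F] [Algebra (ZMod p) F] :
    AddChar F (CycField p) :=
  (AddChar.zmodChar p (zeta_isPrimitiveRoot p).pow_eq_one).compAddMonoidHom
    (Algebra.trace (ZMod p) F).toAddMonoidHom

theorem coe_psi (p : ℕ) [Fact p.Prime] {F : Type*} [Field F] [Algebra (ZMod p) F] (α : F) :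
    ((psi p α : CycField p) : ℂ) =
      Complex.exp (2 * Real.pi * Complex.I / p * (Algebra.trace (ZMod p) F α).val) := by
  have : (psi p α : CycField p) = zeta p ^ (Algebra.trace (ZMod p) F α).val := rfl
  rw [this, mul_comm, Complex.exp_nat_mul]
  rfl

variable (p : ℕ) [Fact p.Prime] {F : Type*} [Field F] [Algebra (ZMod p) F]
  {V : Type*} [AddCommGroup V] [Module F V]

/-- The factor set `f(x, y) = ψ(φ(x, y))`. -/
def fac (φ : LinearMap.BilinForm F V) (x y : V) : CycField p :=
  psi p (φ x y)

/-- The group `Sp(V)` of linear automorphisms preserving `φ`. -/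
def Sp (φ : LinearMap.BilinForm F V) : Subgroup (V ≃ₗ[F] V) where
  carrier := {g | ∀ x y, φ (g x) (g y) = φ x y}
  mul_mem' := fun {a b} ha hb x y => by
    change φ (a (b x)) (a (b y)) = φ x y
    rw [ha, hb]
  one_mem' := fun _ _ => rfl
  inv_mem' := fun {a} ha x y => by
    have h := ha (a⁻¹ x) (a⁻¹ y)
    change φ (a (a.symm x)) (a (a.symm y)) = φ (a.symm x) (a.symm y) at h
    simp only [LinearEquiv.apply_symm_apply] at h
    exact h.symm

/-! ### Elementary properties of `f` -/

section fac

variable {p} (φ : LinearMap.BilinForm F V)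

theorem fac_add_left (x y z : V) : fac p φ (x + y) z = fac p φ x z * fac p φ y z := by
  simp [fac, AddChar.map_add_eq_mul]

theorem fac_add_right (x y z : V) : fac p φ x (y + z) = fac p φ x y * fac p φ x z := by
  simp [fac, AddChar.map_add_eq_mul]

theorem fac_zero_left (x : V) : fac p φ 0 x = 1 := by simp [fac]

theorem fac_zero_right (x : V) : fac p φ x 0 = 1 := by simp [fac]

theorem psi_ne_zero (α : F) : psi p α ≠ 0 := by
  intro h
  have h2 := AddChar.map_add_eq_mul (psi p) α (-α)
  rw [h] at h2
  simp at h2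

theorem exists_psi_ne_one [Finite F] : ∃ α : F, psi p α ≠ 1 := by
  have : Finite (ZMod p) := inferInstance
  obtain ⟨a, ha⟩ := Algebra.trace_surjective (ZMod p) F 1
  refine ⟨a, fun h => one_ne_zero (α := ZMod p) ?_⟩
  rw [← ha]
  have h1 : zeta p ^ (Algebra.trace (ZMod p) F a).val = 1 := h
  have h2 := (zeta_isPrimitiveRoot p).dvd_of_pow_eq_one _ h1
  exact (ZMod.val_eq_zero _).1 (Nat.eq_zero_of_dvd_of_lt h2 (ZMod.val_lt _))

open Classical in
theorem sum_psi [Finite F] {X : Type*} [AddCommGroup X] [Module F X] [Fintype X]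
    (l : X →ₗ[F] F) :
    ∑ x, psi p (l x) = if l = 0 then (Nat.card X : CycField p) else 0 := by
  split_ifs with h
  · simp [h]
  · obtain ⟨α, hα⟩ := exists_psi_ne_one (p := p) (F := F)
    obtain ⟨x, hx⟩ : ∃ x, l x = α := by
      obtain ⟨y, hy⟩ : ∃ y, l y ≠ 0 := by
        by_contra! hc
        exact h (LinearMap.ext hc)
      exact ⟨(α / l y) • y, by simp [hy]⟩
    exact AddChar.sum_eq_zero_of_ne_one
      (ψ := (psi p).compAddMonoidHom l.toAddMonoidHom)
      (AddChar.ne_one_iff.2 ⟨x, by change psi p (l x) ≠ 1; rwa [hx]⟩)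

end fac

/-! ### The symplectic algebra -/

/-- The symplectic algebra: the twisted group ring over `K` of the additive group of `V`, with
factor set `f`. An element is given by its coefficient function: `a` stands for
`∑ v, a.coeff v • (v)`. -/
def SympAlg (_φ : LinearMap.BilinForm F V) : Type _ := V → CycField p

namespace SympAlg

variable {p} {φ : LinearMap.BilinForm F V}

/-- The coefficient of `(v)`. -/
def coeff (a : SympAlg p φ) (v : V) : CycField p := a v

/-- The element with given coefficients. -/
def ofFun (a : V → CycField p) : SympAlg p φ := a

instance instAddCommGroup : AddCommGroup (SympAlg p φ) :=
  inferInstanceAs (AddCommGroup (V → CycField p))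

instance : Module (CycField p) (SympAlg p φ) :=
  inferInstanceAs (Module (CycField p) (V → CycField p))

variable (p φ) in
open Classical in
/-- The basis element `(x)`. -/
def of (x : V) : SympAlg p φ := ofFun fun v => if v = x then 1 else 0

instance : One (SympAlg p φ) := ⟨of p φ 0⟩

theorem ext {a b : SympAlg p φ} (h : ∀ v, a.coeff v = b.coeff v) : a = b := funext h

@[simp] theorem coeff_ofFun (a : V → CycField p) (v : V) :
    (ofFun a : SympAlg p φ).coeff v = a v := rfl
@[simp] theorem coeff_add (a b : SympAlg p φ) (v : V) :
    (a + b).coeff v = a.coeff v + b.coeff v := rfl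
@[simp] theorem coeff_zero (v : V) : (0 : SympAlg p φ).coeff v = 0 := rfl
@[simp] theorem coeff_smul (c : CycField p) (a : SympAlg p φ) (v : V) :
    (c • a).coeff v = c * a.coeff v := rfl

open Classical in
theorem coeff_of (x v : V) : (of p φ x).coeff v = if v = x then 1 else 0 := rfl

theorem one_def : (1 : SympAlg p φ) = of p φ 0 := rfl

theorem coeff_sum {ι : Type*} (s : Finset ι) (a : ι → SympAlg p φ) (v : V) :
    (∑ i ∈ s, a i).coeff v = ∑ i ∈ s, (a i).coeff v :=
  Finset.sum_apply v s (fun i => (a i : V → CycField p))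

variable [Fintype V]

/-- The bilinear multiplication with `(x)(y) = f(x, y) (x + y)`. -/
instance : Mul (SympAlg p φ) :=
  ⟨fun a b => ofFun fun v => ∑ x, a.coeff x * b.coeff (v - x) * fac p φ x (v - x)⟩

theorem coeff_mul (a b : SympAlg p φ) (v : V) :
    (a * b).coeff v = ∑ x, a.coeff x * b.coeff (v - x) * fac p φ x (v - x) := rfl

theorem coeff_of_mul (x : V) (a : SympAlg p φ) (v : V) :
    (of p φ x * a).coeff v = a.coeff (v - x) * fac p φ x (v - x) := by
  rw [coeff_mul, Finset.sum_eq_single x] <;> simp +contextual [coeff_of]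

theorem coeff_mul_of (x : V) (a : SympAlg p φ) (v : V) :
    (a * of p φ x).coeff v = a.coeff (v - x) * fac p φ (v - x) x := by
  rw [coeff_mul, Finset.sum_eq_single (v - x)]
  · simp [coeff_of]
  · intro y _ hy
    have : v - y ≠ x := fun h => hy (by rw [← h]; abel)
    simp [coeff_of, this]
  · simp

/-- The defining multiplication rule. -/
theorem of_mul_of (x y : V) : of p φ x * of p φ y = fac p φ x y • of p φ (x + y) := by
  refine ext fun v => ?_
  rw [coeff_of_mul, coeff_smul, coeff_of, coeff_of]
  by_cases h : v = x + y
  · simp [h]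
  · have : v - x ≠ y := fun h' => h (by rw [← h']; abel)
    simp [h, this]

instance : Ring (SympAlg p φ) where
  __ := instAddCommGroup
  left_distrib a b c := by
    refine ext fun v => ?_
    simp [coeff_mul, mul_add, add_mul, Finset.sum_add_distrib]
  right_distrib a b c := by
    refine ext fun v => ?_
    simp [coeff_mul, add_mul, Finset.sum_add_distrib]
  zero_mul a := by refine ext fun v => ?_; simp [coeff_mul]
  mul_zero a := by refine ext fun v => ?_; simp [coeff_mul]
  one_mul a := by
    refine ext fun v => ?_
    rw [one_def, coeff_of_mul]
    simp [fac_zero_left]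
  mul_one a := by
    refine ext fun v => ?_
    rw [one_def, coeff_mul_of]
    simp [fac_zero_right]
  mul_assoc a b c := by
    refine ext fun v => ?_
    simp only [coeff_mul, Finset.sum_mul, Finset.mul_sum]
    rw [Finset.sum_comm]
    refine Finset.sum_congr rfl fun x _ => ?_
    refine (Fintype.sum_equiv (Equiv.addLeft x) _ _ fun z => ?_).symm
    have e1 : x + z - x = z := by abel
    have e2 : v - (x + z) = v - x - z := by abel
    have e3 : v - x = z + (v - x - z) := by abel
    simp only [Equiv.coe_addLeft, e1, e2]
    have e4 : fac p φ x (v - x) = fac p φ x z * fac p φ x (v - x - z) := by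
      rw [← fac_add_right, ← e3]
    rw [e4, fac_add_left]
    ring

instance : Algebra (CycField p) (SympAlg p φ) :=
  Algebra.ofModule
    (fun c a b => by
      refine ext fun v => ?_
      simp only [coeff_mul, coeff_smul, Finset.mul_sum]
      exact Finset.sum_congr rfl fun x _ => by ring)
    (fun c a b => by
      refine ext fun v => ?_
      simp only [coeff_mul, coeff_smul, Finset.mul_sum]
      exact Finset.sum_congr rfl fun x _ => by ring)

theorem eq_sum (a : SympAlg p φ) : a = ∑ x, a.coeff x • of p φ x := by
  classical
  refine ext fun v => ?_
  simp [coeff_sum, coeff_of]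

theorem finrank_eq : Module.finrank (CycField p) (SympAlg p φ) = Fintype.card V :=
  Module.finrank_fintype_fun_eq_card (CycField p)

instance : FiniteDimensional (CycField p) (SympAlg p φ) :=
  inferInstanceAs (FiniteDimensional (CycField p) (V → CycField p))

end SympAlg

open SympAlg

/-! ### The elements `s(g)` -/

variable [Fintype V]

section spin

variable {p} {φ : LinearMap.BilinForm F V}

/-- `s` is an invertible element of the symplectic algebra with `(0)`-coefficient `1` and
`s⁻¹ (x) s = (x^g)` for all `x`. -/
def IsSpin (g : V ≃ₗ[F] V) (s : SympAlg p φ) : Prop :=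
  IsUnit s ∧ s.coeff 0 = 1 ∧ ∀ x, of p φ x * s = s * of p φ (g x)

variable (p) in
/-- `s(g)`: the element of the symplectic algebra characterized by `IsSpin g`
(it exists and is unique, by `existsUnique_isSpin`). -/
def spin (g : Sp φ) : SympAlg p φ :=
  Classical.epsilon (IsSpin (g : V ≃ₗ[F] V))

theorem eq_zero_of_fac_eq_one [Finite F] (hφ : φ.Nondegenerate) {v : V}
    (h : ∀ x, fac p φ v x = 1) : v = 0 := by
  obtain ⟨α, hα⟩ := exists_psi_ne_one (p := p) (F := F)
  refine hφ.1 v fun y => ?_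
  by_contra hy
  apply hα
  have h1 := h ((α / φ v y) • y)
  rwa [fac, map_smul, smul_eq_mul, div_mul_cancel₀ _ hy] at h1

theorem fac_neg_left (x y : V) : fac p φ (-x) y = (fac p φ x y)⁻¹ := by
  refine eq_inv_of_mul_eq_one_left ?_
  rw [← fac_add_left, neg_add_cancel, fac_zero_left]

theorem fac_neg_right (x y : V) : fac p φ x (-y) = (fac p φ x y)⁻¹ := by
  refine eq_inv_of_mul_eq_one_left ?_
  rw [← fac_add_right, neg_add_cancel, fac_zero_right]

theorem fac_swap (hφ : φ.IsAlt) (x y : V) : fac p φ y x = (fac p φ x y)⁻¹ := by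
  rw [← fac_neg_right]
  simp [fac, ← hφ.neg_eq x y]

theorem fac_ne_zero (x y : V) : fac p φ x y ≠ 0 := psi_ne_zero _

theorem fac_self (hφ : φ.IsAlt) (x : V) : fac p φ x x = 1 := by
  simp [fac, hφ.self_eq_zero x]

theorem two_ne_zero_of (hp : p ≠ 2) : (2 : F) ≠ 0 := by
  have h : ((2 : ℕ) : ZMod p) ≠ 0 := by
    rw [Ne, ZMod.natCast_eq_zero_iff]
    intro h
    exact hp ((Nat.prime_dvd_prime_iff_eq Fact.out Nat.prime_two).1 h)
  have h2 := (map_ne_zero (algebraMap (ZMod p) F)).2 h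
  rwa [map_natCast, Nat.cast_ofNat] at h2

/-- An element commuting with every `(x)` is a scalar. -/
theorem eq_smul_one [Finite F] (hp : p ≠ 2) (hφ : φ.IsAlt) (hφ' : φ.Nondegenerate)
    {a : SympAlg p φ} (h : ∀ x, of p φ x * a = a * of p φ x) :
    a = a.coeff 0 • (1 : SympAlg p φ) := by
  refine SympAlg.ext fun v => ?_
  rw [coeff_smul, one_def, coeff_of]
  split_ifs with hv
  · simp [hv]
  · rw [mul_zero]
    by_contra ha
    apply hv
    have h2 : (2 : F) • v = 0 := by
      refine eq_zero_of_fac_eq_one (p := p) hφ' fun x => ?_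
      have h1 := congrArg (fun b => b.coeff (v + x)) (h x)
      simp only [coeff_of_mul, coeff_mul_of, add_sub_cancel_right] at h1
      have h3 := mul_left_cancel₀ ha h1
      rw [fac_swap hφ v x] at h3
      rw [two_smul, fac_add_left]
      nth_rewrite 1 [← h3]
      exact inv_mul_cancel₀ (fac_ne_zero v x)
    exact (smul_eq_zero.1 h2).resolve_left (two_ne_zero_of hp)

theorem IsSpin.eq [Finite F] (hp : p ≠ 2) (hφ : φ.IsAlt) (hφ' : φ.Nondegenerate)
    {g : V ≃ₗ[F] V} {s t : SympAlg p φ} (hs : IsSpin g s) (ht : IsSpin g t) : s = t := by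
  obtain ⟨u, rfl⟩ := ht.1
  have h : ∀ x, of p φ x * (s * (u⁻¹ : (SympAlg p φ)ˣ)) =
      (s * (u⁻¹ : (SympAlg p φ)ˣ)) * of p φ x := by
    intro x
    have h1 := ht.2.2 x
    have h2 : (↑u⁻¹ : SympAlg p φ) * of p φ x = of p φ (g x) * ↑u⁻¹ := by
      rw [Units.inv_mul_eq_iff_eq_mul, ← mul_assoc, ← h1, mul_assoc, Units.mul_inv, mul_one]
    rw [← mul_assoc, hs.2.2 x, mul_assoc, mul_assoc, h2]
  have h3 := eq_smul_one hp hφ hφ' h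
  set c := (s * (↑u⁻¹ : SympAlg p φ)).coeff 0
  have h4 : s = c • (u : SympAlg p φ) := by
    have := congrArg (· * (u : SympAlg p φ)) h3
    simpa [mul_assoc] using this
  have h5 := congrArg (fun b => b.coeff 0) h4
  simp only [coeff_smul, hs.2.1, ht.2.1, mul_one] at h5
  rw [h4, ← h5, one_smul]

/-- Existence and uniqueness of `s(g)`. -/
theorem existsUnique_isSpin [Finite F] (hp : p ≠ 2) (hφ : φ.IsAlt) (hφ' : φ.Nondegenerate)
    (g : Sp φ) : ∃! s : SympAlg p φ, IsSpin (g : V ≃ₗ[F] V) s := by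
  classical
  obtain ⟨g, hg⟩ := g
  have hg : ∀ x y, φ (g x) (g y) = φ x y := hg
  have hsw : ∀ x y, φ x y = - φ y x := fun x y => (hφ.neg_eq y x).symm
  let U : Submodule F V := LinearMap.range (g.toLinearMap - LinearMap.id)
  have hU : ∀ v, v ∈ U ↔ ∃ x, g x - x = v := fun v => Iff.rfl
  -- the value of the quadratic form is well defined
  have hQ : ∀ x y, g x - x = g y - y → φ (g x) x = φ (g y) y := by
    intro x y h
    have e1 : g (x - y) = x - y := by
      rw [map_sub, ← sub_eq_zero]
      calc g x - g y - (x - y) = (g x - x) - (g y - y) := by abel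
        _ = 0 := by rw [h, sub_self]
    have e3 := hg x (x - y)
    rw [e1] at e3
    simp only [map_sub] at e3
    have h' := congrArg (fun z => φ z y) h
    simp only [map_sub, LinearMap.sub_apply] at h'
    linear_combination e3 + h' + hφ.self_eq_zero x - hφ.self_eq_zero y
  obtain ⟨q, hq⟩ : ∃ q : V → F, ∀ x, q (g x - x) = φ (g x) x := by
    refine ⟨fun v => if h : ∃ x, g x - x = v then φ (g h.choose) h.choose else 0, fun x => ?_⟩
    have h : ∃ y, g y - y = g x - x := ⟨x, rfl⟩
    simp only [dif_pos h]
    exact hQ _ _ h.choose_spec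
  let s : SympAlg p φ := ofFun fun v => if v ∈ U then psi p (q v) else 0
  let t : SympAlg p φ := ofFun fun v => if v ∈ U then psi p (-q v) else 0
  have hs0 : s.coeff 0 = 1 := by
    have h0 := hq 0
    simp only [map_zero, sub_zero] at h0
    simp [s, h0]
  have hint : ∀ x, of p φ x * s = s * of p φ (g x) := by
    intro x
    refine SympAlg.ext fun v => ?_
    rw [coeff_of_mul, coeff_mul_of]
    simp only [s, coeff_ofFun]
    have hm : v - g x ∈ U ↔ v - x ∈ U := by
      have : v - x = v - g x + (g x - x) := by abel
      rw [this]
      exact (U.add_mem_iff_left ((hU _).2 ⟨x, rfl⟩)).symm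
    by_cases h : v - x ∈ U
    · rw [if_pos h, if_pos (hm.2 h)]
      obtain ⟨z, hz⟩ := (hU _).1 h
      have hv : v - g x = g (z - x) - (z - x) := by
        rw [map_sub]
        calc v - g x = (v - x) - (g x - x) := by abel
          _ = g z - z - (g x - x) := by rw [hz]
          _ = _ := by abel
      rw [hv, ← hz, hq, hq, fac, fac, ← AddChar.map_add_eq_mul, ← AddChar.map_add_eq_mul]
      congr 1
      simp only [map_sub, LinearMap.sub_apply]
      linear_combination hsw x (g z) - hsw x z - hg z x + hg x x + hsw (g x) z -
        hsw (g x) x + hφ.self_eq_zero x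
    · rw [if_neg h, if_neg (fun h' => h (hm.1 h'))]
      simp
  have hts : t * s = (Nat.card U : CycField p) • (1 : SympAlg p φ) := by
    refine SympAlg.ext fun v => ?_
    rw [coeff_smul, one_def, coeff_of, coeff_mul]
    by_cases hv : v ∈ U
    · obtain ⟨x, rfl⟩ := (hU _).1 hv
      let l : U →ₗ[F] F := (-2 : F) • (φ.flip x ∘ₗ U.subtype)
      have hlapp : ∀ y : U, l y = -2 * φ y x := fun y => rfl
      have hl : l = 0 ↔ g x - x = 0 := by
        constructor
        · intro h
          refine hφ'.2 _ fun z' => ?_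
          obtain ⟨z, rfl⟩ := g.surjective z'
          have h1 := hlapp ⟨g z - z, (hU _).2 ⟨z, rfl⟩⟩
          rw [h, LinearMap.zero_apply] at h1
          have h2 : φ (g z - z) x = 0 :=
            (mul_eq_zero.1 h1.symm).resolve_left (neg_ne_zero.2 (two_ne_zero_of hp))
          rw [map_sub, LinearMap.sub_apply] at h2
          rw [map_sub, hg]
          linear_combination -h2
        · intro h
          refine LinearMap.ext fun y => ?_
          obtain ⟨z, hz⟩ := (hU _).1 y.2
          rw [hlapp, ← hz, LinearMap.zero_apply]
          have h1 := hg z x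
          rw [sub_eq_zero.1 h] at h1
          simp [h1]
      have h1 : ∀ y : U, t.coeff y * s.coeff (g x - x - y) * fac p φ y (g x - x - y) =
          psi p (q (g x - x)) * psi p (l y) := by
        rintro ⟨y, hy⟩
        simp only [t, s, coeff_ofFun, if_pos hy, if_pos (U.sub_mem hv hy)]
        obtain ⟨z, rfl⟩ := (hU _).1 hy
        have e : g x - x - (g z - z) = g (x - z) - (x - z) := by
          rw [map_sub]
          abel
        rw [e, hq, hq, hq, fac, ← AddChar.map_add_eq_mul, ← AddChar.map_add_eq_mul,
          ← AddChar.map_add_eq_mul]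
        congr 1
        rw [hlapp]
        simp only [map_sub, LinearMap.sub_apply]
        linear_combination hg z x + hsw x (g z) - hsw x z - 2 * hsw (g z) x + hsw (g x) z +
          hsw (g z) z - hφ.self_eq_zero (g z) - hφ.self_eq_zero z + hsw (g z) x + hsw z x -
          2 * hsw (g x) z
      have h2 : ∑ y : V, t.coeff y * s.coeff (g x - x - y) * fac p φ y (g x - x - y) =
          ∑ y : U, t.coeff y * s.coeff (g x - x - y) * fac p φ y (g x - x - y) := by
        rw [← Finset.sum_subtype (Finset.univ.filter (· ∈ U)) (fun v => by
            rw [Finset.mem_filter, and_iff_right (Finset.mem_univ v)])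
          (fun y => t.coeff y * s.coeff (g x - x - y) * fac p φ y (g x - x - y))]
        refine (Finset.sum_filter_of_ne fun y _ h => ?_).symm
        by_contra hy
        simp [t, hy] at h
      rw [h2, Finset.sum_congr rfl fun y _ => h1 y, ← Finset.mul_sum, sum_psi]
      by_cases hx : g x - x = 0
      · have h0 := hq 0
        simp only [map_zero, sub_zero] at h0
        simp [hl.2 hx, hx, h0]
      · simp [mt hl.1 hx, hx]
    · have hv0 : v ≠ 0 := fun h => hv (h ▸ U.zero_mem)
      rw [if_neg hv0, mul_zero]
      refine Finset.sum_eq_zero fun y _ => ?_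
      by_cases hy : y ∈ U
      · have : v - y ∉ U := fun h => hv (by simpa using U.add_mem h hy)
        simp [s, this]
      · simp [t, hy]
  have hunit : IsUnit s := by
    have hc : (Nat.card U : CycField p) ≠ 0 := Nat.cast_ne_zero.2 Nat.card_pos.ne'
    have h1 : ((Nat.card U : CycField p)⁻¹ • t) * s = 1 := by
      rw [smul_mul_assoc, hts, smul_smul, inv_mul_cancel₀ hc, one_smul]
    have : IsArtinianRing (SympAlg p φ) := IsArtinianRing.of_finite (CycField p) _
    exact IsUnit.of_mul_eq_one_right _ h1
  exact ⟨s, ⟨hunit, hs0, hint⟩, fun s' hs' => hs'.eq hp hφ hφ' ⟨hunit, hs0, hint⟩⟩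

theorem spin_spec [Finite F] (hp : p ≠ 2) (hφ : φ.IsAlt) (hφ' : φ.Nondegenerate) (g : Sp φ) :
    IsSpin (g : V ≃ₗ[F] V) (spin p g) :=
  Classical.epsilon_spec (existsUnique_isSpin hp hφ hφ' g).exists

end spin

/-! ### The matrix realization -/

/-- A subspace is Lagrangian if it is maximal among the totally isotropic subspaces. -/
def IsLagrangian (φ : LinearMap.BilinForm F V) (W : Submodule F V) : Prop :=
  Maximal (fun U : Submodule F V => ∀ x ∈ U, ∀ y ∈ U, φ x y = 0) W

/-- A decomposition `V = W ⊕ W*` into two complementary Lagrangian subspaces. -/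
structure Polarization (φ : LinearMap.BilinForm F V) where
  W : Submodule F V
  Wstar : Submodule F V
  lagrangian_W : IsLagrangian φ W
  lagrangian_Wstar : IsLagrangian φ Wstar
  isCompl : IsCompl W Wstar

/-- `P` is one half of a partition `Z = P ∪ -P ∪ {0}`. -/
def IsHalf {Z : Type*} [AddGroup Z] (P : Set Z) : Prop :=
  0 ∉ P ∧ ∀ a : Z, a ≠ 0 → (a ∈ P ∨ -a ∈ P) ∧ ¬ (a ∈ P ∧ -a ∈ P)

variable {φ : LinearMap.BilinForm F V}

open Classical in
/-- `e₀ = q⁻ⁿ ∑_{w ∈ W} (w)`, where `qⁿ = |W|`. -/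
def e0 (D : Polarization φ) : SympAlg p φ :=
  (Nat.card D.W : CycField p)⁻¹ • ∑ w : D.W, of p φ w

/-- The matrix units `e_{ab} = (-a) e₀ (b)`, for `a, b ∈ W*`. -/
def matUnit (D : Polarization φ) (a b : D.Wstar) : SympAlg p φ :=
  of p φ (-a) * e0 p D * of p φ b

open Classical in
/-- The element `∑ M_{ab} e_{ab}` of the symplectic algebra. -/
def ofMatrix (D : Polarization φ) :
    Matrix D.Wstar D.Wstar (CycField p) →ₗ[CycField p] SympAlg p φ where
  toFun M := ∑ a, ∑ b, M a b • matUnit p D a b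
  map_add' M N := by simp [add_smul, Finset.sum_add_distrib]
  map_smul' c M := by simp [Finset.smul_sum, smul_smul]

/-- The matrix `[𝔞]` of `𝔞`: the matrix `(α_{ab})` with `𝔞 = ∑ α_{ab} e_{ab}`
(it exists and is unique, by `ofMatrix_bijective`). -/
def toMatrix (D : Polarization φ) (a : SympAlg p φ) : Matrix D.Wstar D.Wstar (CycField p) :=
  Function.invFun (ofMatrix p D) a

/-- With rows and columns arranged as `P, -P, 0` and blocks `A`, `B` in positions `(P, P)` and
`(P, -P)` of `[𝔞]`, this is the matrix `A - B`. On the centralizer of `j = q⁻ⁿ ∑_v (v)`, which contains every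
`s(g)`, it is the homomorphism `𝔞 ↦ 𝔞^♭`. -/
def flat (D : Polarization φ) (P : Set D.Wstar) (a : SympAlg p φ) : Matrix P P (CycField p) :=
  Matrix.of fun x y => toMatrix p D a x y - toMatrix p D a x (-y)

open Classical in
/-- `η(g) = (det s(g)^♭)² (det s(g))⁻¹`, computed from the decomposition `V = W ⊕ W*` and the
half-system `P` in `W*`. -/
def eta (D : Polarization φ) (P : Set D.Wstar) (g : Sp φ) : CycField p :=
  (flat p D P (spin p g)).det ^ 2 * (toMatrix p D (spin p g)).det⁻¹

/-- The map `g*` on `W*` with `W + a^{g*} = W + a^g`: apply `g`, then project onto `W*`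
along `W`. -/
def gStar (D : Polarization φ) (g : Sp φ) : D.Wstar →ₗ[F] D.Wstar :=
  D.Wstar.projectionOnto D.W D.isCompl.symm ∘ₗ
    (g : V ≃ₗ[F] V).toLinearMap ∘ₗ D.Wstar.subtype

theorem gStar_spec (D : Polarization φ) (g : Sp φ) (a : D.Wstar) :
    (g : V ≃ₗ[F] V) a - gStar D g a ∈ D.W :=
  Submodule.sub_projection_mem D.isCompl.symm _

section bijective

variable (D : Polarization φ)

open Classical in
theorem coeff_e0 (v : V) :
    (e0 p D).coeff v = if v ∈ D.W then (Nat.card D.W : CycField p)⁻¹ else 0 := by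
  rw [e0, coeff_smul, coeff_sum]
  split_ifs with h
  · rw [Finset.sum_eq_single (⟨v, h⟩ : D.W)]
    · simp [coeff_of]
    · intro w _ hw
      rw [coeff_of, if_neg]
      rintro rfl
      exact hw rfl
    · simp
  · rw [Finset.sum_eq_zero, mul_zero]
    intro w _
    rw [coeff_of, if_neg]
    rintro rfl
    exact h w.2

theorem coeff_matUnit (a b : D.Wstar) (v : V) :
    (matUnit p D a b).coeff v =
      (e0 p D).coeff (v - b + a) * fac p φ (-a) (v - b + a) * fac p φ (v - b) b := by
  rw [matUnit, coeff_mul_of, coeff_of_mul, sub_neg_eq_add]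

/-- The functional `φ(w, ·)` on `W*` vanishes only for `w = 0`. -/
theorem eq_zero_of_pairing (hφ' : φ.Nondegenerate) {W W' : Submodule F V} (h : IsCompl W W')
    (hW : IsLagrangian φ W) {w : V} (hw : w ∈ W) (h0 : ∀ a ∈ W', φ w a = 0) : w = 0 := by
  refine hφ'.1 w fun v => ?_
  obtain ⟨x, hx, y, hy, rfl⟩ := Submodule.mem_sup.1 (h.sup_eq_top ▸ Submodule.mem_top (x := v))
  rw [map_add, hW.prop w hw x hx, h0 y hy, add_zero]

theorem finrank_le_of_pairing (hφ' : φ.Nondegenerate) {W W' : Submodule F V} (h : IsCompl W W')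
    (hW : IsLagrangian φ W) : Module.finrank F W ≤ Module.finrank F W' := by
  let T : W →ₗ[F] Module.Dual F W' := (LinearMap.lcomp F F W'.subtype) ∘ₗ φ ∘ₗ W.subtype
  have hT : Function.Injective T := by
    rw [← LinearMap.ker_eq_bot, LinearMap.ker_eq_bot']
    intro w hw
    refine Subtype.ext (eq_zero_of_pairing hφ' h hW w.2 fun a ha => ?_)
    exact LinearMap.congr_fun hw ⟨a, ha⟩
  exact (LinearMap.finrank_le_finrank_of_injective hT).trans_eq Subspace.dual_finrank_eq

theorem card_eq [Finite F] (hφ' : φ.Nondegenerate) : Nat.card D.W = Nat.card D.Wstar := by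
  have h := le_antisymm (finrank_le_of_pairing hφ' D.isCompl D.lagrangian_W)
    (finrank_le_of_pairing hφ' D.isCompl.symm D.lagrangian_Wstar)
  rw [Module.natCard_eq_pow_finrank (K := F), Module.natCard_eq_pow_finrank (K := F) (V := D.Wstar),
    h]

theorem of_mem_range [Finite F] (hp : p ≠ 2) (hφ : φ.IsAlt) (hφ' : φ.Nondegenerate) (x : V) :
    of p φ x ∈ LinearMap.range (ofMatrix p D) := by
  classical
  obtain ⟨w₀, hw₀, c, hc, rfl⟩ :=
    Submodule.mem_sup.1 (D.isCompl.sup_eq_top ▸ Submodule.mem_top (x := x))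
  refine ⟨Matrix.of fun a b => if b = a + ⟨c, hc⟩ then
    fac p φ a (a + c) * fac p φ w₀ (-(a + a + c)) else 0, ?_⟩
  refine SympAlg.ext fun v => ?_
  change (∑ a, ∑ b, _ • matUnit p D a b).coeff v = _
  simp only [coeff_sum, coeff_smul, Matrix.of_apply, ite_mul, zero_mul, Finset.sum_ite_eq',
    Finset.mem_univ, if_true, coeff_matUnit, Submodule.coe_add]
  have e (a : D.Wstar) : v - (a + c) + a = v - c := by abel
  simp only [e, coeff_e0]
  by_cases hv : v - c ∈ D.W
  · simp only [if_pos hv]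
    obtain ⟨w, hw, rfl⟩ : ∃ w ∈ D.W, v = w + c := ⟨v - c, hv, by abel⟩
    let l : D.Wstar →ₗ[F] F := (2 : F) • (φ (w - w₀) ∘ₗ D.Wstar.subtype)
    have hl : l = 0 ↔ w = w₀ := by
      constructor
      · intro h
        rw [← sub_eq_zero]
        refine eq_zero_of_pairing hφ' D.isCompl D.lagrangian_W (D.W.sub_mem hw hw₀) fun a ha => ?_
        have h1 : 2 * φ (w - w₀) a = 0 := LinearMap.congr_fun h ⟨a, ha⟩
        exact (mul_eq_zero.1 h1).resolve_left (two_ne_zero_of hp)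
      · rintro rfl
        simp [l]
    have key (a : D.Wstar) : fac p φ a (a + c) * fac p φ w₀ (-(a + a + c)) *
        ((Nat.card D.W : CycField p)⁻¹ * fac p φ (-a) (w + c - c) *
          fac p φ (w + c - (a + c)) (a + c)) =
        (Nat.card D.W : CycField p)⁻¹ * fac p φ (w - w₀) c * psi p (l a) := by
      have h1 : fac p φ a (a + c) * fac p φ w₀ (-(a + a + c)) *
          (fac p φ (-a) (w + c - c) * fac p φ (w + c - (a + c)) (a + c)) =
          fac p φ (w - w₀) c * psi p (l a) := by
        simp only [fac, ← AddChar.map_add_eq_mul]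
        congr 1
        have : l a = 2 * φ (w - w₀) a := rfl
        rw [this]
        simp only [map_add, map_sub, map_neg, LinearMap.add_apply, LinearMap.sub_apply,
          LinearMap.neg_apply]
        linear_combination hφ.neg_eq w a
      linear_combination (Nat.card D.W : CycField p)⁻¹ * h1
    rw [Finset.sum_congr rfl fun a _ => key a, ← Finset.mul_sum, sum_psi, coeff_of]
    by_cases h : w = w₀
    · have hc0 : (Nat.card D.Wstar : CycField p) ≠ 0 := Nat.cast_ne_zero.2 Nat.card_pos.ne'
      rw [if_pos (hl.2 h), if_pos (by rw [h]), h, sub_self, fac_zero_left, mul_one,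
        card_eq D hφ', inv_mul_cancel₀ hc0]
    · rw [if_neg (mt hl.1 h), if_neg (by simpa using h), mul_zero]
  · have : v ≠ w₀ + c := by
      rintro rfl
      exact hv (by simpa using hw₀)
    simp [coeff_of, this, hv]

/-- The `e_{ab}` form a basis of the symplectic algebra. -/
theorem ofMatrix_bijective [Finite F] (hp : p ≠ 2) (hφ : φ.IsAlt) (hφ' : φ.Nondegenerate) :
    Function.Bijective (ofMatrix p D) := by
  classical
  have hs : Function.Surjective (ofMatrix p D) := by
    rw [← LinearMap.range_eq_top, eq_top_iff]
    intro a _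
    rw [eq_sum a]
    exact Submodule.sum_mem _ fun x _ => Submodule.smul_mem _ _ (of_mem_range p D hp hφ hφ' x)
  refine ⟨(LinearMap.injective_iff_surjective_of_finrank_eq_finrank ?_).2 hs, hs⟩
  rw [finrank_eq, Module.finrank_matrix, Module.finrank_self, mul_one, ← Nat.card_eq_fintype_card,
    ← Nat.card_eq_fintype_card, Nat.card_congr
      (Submodule.prodEquivOfIsCompl _ _ D.isCompl).symm.toEquiv, Nat.card_prod, card_eq D hφ']

theorem ofMatrix_toMatrix [Finite F] (hp : p ≠ 2) (hφ : φ.IsAlt) (hφ' : φ.Nondegenerate)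
    (a : SympAlg p φ) : ofMatrix p D (toMatrix p D a) = a :=
  Function.invFun_eq ((ofMatrix_bijective p D hp hφ hφ').2 a)

end bijective

end WeilRep

end

namespace WeilRep

/-! ### Permutation signs of linear maps over finite fields (Zolotarev's lemma) -/

section Zolotarev

open Equiv Matrix

variable {F : Type*} [Field F] [Fintype F] [DecidableEq F]

/-! First, `η(g)` depends on no choices (`eta_eq_eta`), so it may be computed from the pair `W, W*`
adapted to `g`. Two identifications of the algebra with a matrix algebra differ by a conjugation, so
they give the same determinant. The other factor `det s^♭` is the determinant of `s` on odd
functions, that is, of `1 + (s - 1)(1 - j)/2` with `j = |W|⁻¹ ∑ (v)`, an expression free of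
polarization and half-system because `|W|² = |V|` (`det_flat`).

Second, when `W^g = W`, the element `s = s(g)` commutes with the primitive idempotent `e₀`, so `e₀ s
= λ e₀`, where `λ` is the sum of the coefficients of `s` on `W`. Those coefficients vanish off
`V^{g-1}` and equal `f(x^g, x)` at `x^g - x`, so `λ` is the stated denominator; it is nonzero since
`s` is a unit. Then `e_{aa} s = c(a) e_{a, a^{g*}}` with `c(a) = λ f(a^{g*}, a^g)`: the matrix of
`s` is monomial (`IsSpin.toMatrix_eq`).

Third, `c` is even and `c(0) = λ`, so `det s = sign(g*) λ ∏_P c²`, while `(det s^♭)² = ∏_P c²`.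
Their quotient is `sign(g*)/λ`, and the sign of `g*` as a permutation of `W*` is `χ(det g*)` by
Zolotarev's lemma (`sign_linearEquiv`). -/

theorem sign_mulLeft_generator {z : Fˣ} (hz : ∀ x, x ∈ Subgroup.zpowers z)
    (hF : ringChar F ≠ 2) : Perm.sign (MulAction.toPerm z : Perm F) = -1 := by
  have hz1 : z ≠ 1 := by
    rintro rfl
    obtain ⟨k, hk⟩ := hz (-1)
    simp only [_root_.one_zpow] at hk
    exact Ring.neg_one_ne_one_of_char_ne_two hF (by simpa using (congrArg Units.val hk).symm)
  have hmoved : ∀ y : F, (MulAction.toPerm z : Perm F) y ≠ y ↔ y ≠ 0 := by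
    intro y
    refine not_congr ⟨fun h => ?_, fun h => by simp [h]⟩
    by_contra hy
    refine hz1 (Units.ext ?_)
    have h1 : (z : F) * y = y := h
    simpa using mul_right_cancel₀ hy (h1.trans (one_mul y).symm)
  have hcyc : (MulAction.toPerm z : Perm F).IsCycle := by
    refine ⟨1, (hmoved 1).2 one_ne_zero, fun y hy => ?_⟩
    obtain ⟨k, hk⟩ := hz (Units.mk0 y ((hmoved y).1 hy))
    refine ⟨k, ?_⟩
    have h1 : (MulAction.toPerm z : Perm F) ^ k = MulAction.toPerm (z ^ k) :=
      (map_zpow (MulAction.toPermHom Fˣ F) z k).symm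
    rw [h1, MulAction.toPerm_apply, Units.smul_def, smul_eq_mul, mul_one]
    exact congrArg Units.val hk
  have hsupp : (MulAction.toPerm z : Perm F).support = Finset.univ.erase 0 := by
    ext y
    rw [Perm.mem_support, hmoved]
    simp
  rw [hcyc.sign, hsupp, Finset.card_erase_of_mem (Finset.mem_univ _), Finset.card_univ]
  have hodd := FiniteField.odd_card_of_char_ne_two hF
  rw [Even.neg_one_pow (Nat.Odd.sub_odd (Nat.odd_iff.2 hodd) odd_one)]

/-- Both sides are multiplicative in `u`, so a generator of the cyclic group suffices. There the
permutation is a single cycle of even length `q - 1`, and a generator is not a square. -/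
theorem sign_mulLeft (hF : ringChar F ≠ 2) (u : Fˣ) :
    ((Perm.sign (MulAction.toPerm u : Perm F) : ℤˣ) : ℤ) = quadraticChar F u := by
  obtain ⟨z, hz⟩ := IsCyclic.exists_generator (α := Fˣ)
  have hχ : quadraticChar F z = -1 := by
    obtain ⟨a, ha⟩ := quadraticChar_exists_neg_one' hF
    obtain ⟨k, rfl⟩ := mem_powers_iff_mem_zpowers.2 (hz a)
    refine (quadraticChar_dichotomy z.ne_zero).resolve_left fun h => ?_
    rw [Units.val_pow_eq_pow_val, map_pow, h, one_pow] at ha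
    exact absurd ha (by decide)
  obtain ⟨k, rfl⟩ := mem_powers_iff_mem_zpowers.2 (hz u)
  have h1 : (MulAction.toPerm (z ^ k) : Perm F) = MulAction.toPerm z ^ k :=
    map_pow (MulAction.toPermHom Fˣ F) z k
  simp only [h1, map_pow, sign_mulLeft_generator hz hF, Units.val_pow_eq_pow_val, hχ]
  simp

variable {ι : Type*} [Fintype ι] [DecidableEq ι]

/-- Splitting off the `i`-th coordinate leaves one copy of multiplication by `u` on `F` for each
choice of the other coordinates. The number of copies is a power of `q`, hence odd, so the sign is
unchanged. -/
theorem sign_pi_mulSingle (hF : ringChar F ≠ 2) (i : ι) (u : Fˣ) :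
    ((Perm.sign (MulAction.toPerm (Pi.mulSingle i u : ι → Fˣ) : Perm (ι → F)) : ℤˣ) : ℤ) =
      quadraticChar F u := by
  have h : Perm.sign (MulAction.toPerm (Pi.mulSingle i u : ι → Fˣ) : Perm (ι → F)) =
      Perm.sign (prodCongrLeft (α₁ := {j // j ≠ i} → F)
        fun _ => (MulAction.toPerm u : Perm F)) := by
    refine Perm.sign_eq_sign_of_equiv _ _ (funSplitAt i F) fun v => ?_
    refine Prod.ext ?_ (funext fun j => ?_)
    · simp [prodCongrLeft]
    · have := j.2
      simp [prodCongrLeft, Pi.mulSingle_eq_of_ne this]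
  rw [h, Perm.sign_prodCongrLeft, Finset.prod_const, ← sign_mulLeft hF u, Finset.card_univ,
    Fintype.card_fun]
  obtain ⟨m, hm⟩ := (Nat.odd_iff.2 (FiniteField.odd_card_of_char_ne_two hF)).pow
    (n := Fintype.card {j // j ≠ i})
  rw [hm, pow_succ, pow_mul]
  rcases Int.units_eq_one_or (Perm.sign (MulAction.toPerm u : Perm F)) with h | h <;> simp [h]

theorem sign_pi_smul (hF : ringChar F ≠ 2) (d : ι → Fˣ) :
    ((Perm.sign (MulAction.toPerm d : Perm (ι → F)) : ℤˣ) : ℤ) =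
      quadraticChar F (∏ i, (d i : F)) := by
  let f : (ι → Fˣ) →* ℤ := (Units.coeHom ℤ).comp
    (Perm.sign.comp (MulAction.toPermHom (ι → Fˣ) (ι → F)))
  let h : (ι → Fˣ) →* ℤ := (quadraticChar F).toMonoidHom.comp
    ((Units.coeHom F).comp
      { toFun := fun d => ∏ i, d i, map_one' := by simp, map_mul' := by
          intro a b; simp [Finset.prod_mul_distrib] })
  have hfh : f = h := by
    refine MonoidHom.functions_ext _ _ _ fun i u => ?_
    refine (sign_pi_mulSingle hF i u).trans ?_
    change _ = quadraticChar F ((∏ j, (Pi.mulSingle i u : ι → Fˣ) j : Fˣ) : F)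
    rw [Finset.prod_pi_mulSingle', if_pos (Finset.mem_univ i)]
  have h2 := DFunLike.congr_fun hfh d
  refine h2.trans ?_
  change quadraticChar F ((∏ j, d j : Fˣ) : F) = _
  rw [Units.coe_prod]

omit [Fintype F] [DecidableEq F] in
theorem exists_perm_mulVec {M : Matrix ι ι F} (hM : M.det ≠ 0) :
    ∃ e : Perm (ι → F), ∀ v, e v = M *ᵥ v := by
  have hu : IsUnit M := (Matrix.isUnit_iff_isUnit_det M).2 hM.isUnit
  exact ⟨Equiv.ofBijective _ ⟨mulVec_injective_iff_isUnit.2 hu, mulVec_surjective_iff_isUnit.2 hu⟩,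
    fun v => rfl⟩

/-- The sign of an invertible matrix over a finite field of odd order, acting as a permutation of
the column vectors, is the quadratic character of its determinant. -/
theorem sign_mulVec (hF : ringChar F ≠ 2) {M : Matrix ι ι F} (hM : M.det ≠ 0)
    (e : Perm (ι → F)) (he : ∀ v, e v = M *ᵥ v) :
    ((Perm.sign e : ℤˣ) : ℤ) = quadraticChar F M.det := by
  revert e
  refine diagonal_transvection_induction_of_det_ne_zero
    (fun M => ∀ e : Perm (ι → F), (∀ v, e v = M *ᵥ v) →
      ((Perm.sign e : ℤˣ) : ℤ) = quadraticChar F M.det) M hM ?_ ?_ ?_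
  · intro d hd e he
    rw [det_diagonal] at hd ⊢
    have hd' : ∀ i, d i ≠ 0 := fun i => Finset.prod_ne_zero_iff.1 hd i (Finset.mem_univ i)
    have : e = MulAction.toPerm (fun i => Units.mk0 (d i) (hd' i)) := by
      ext v i
      rw [he, mulVec_diagonal]
      rfl
    rw [this, sign_pi_smul hF]
    simp
  · rintro ⟨i, j, hij, c⟩ e he
    have : NeZero (2 : F) := ⟨Ring.two_ne_zero hF⟩
    -- A transvection with parameter `c` is the square of the one with parameter `c / 2`, so it is
    -- an even permutation.
    have hdet : (transvection i j (c / 2)).det ≠ 0 := by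
      rw [det_transvection_of_ne _ _ hij]; exact one_ne_zero
    obtain ⟨e', he'⟩ := exists_perm_mulVec hdet
    have : e = e' * e' := by
      ext1 v
      rw [he, Perm.mul_apply, he', he', mulVec_mulVec, transvection_mul_transvection_same _ _ hij,
        add_halves]
      rfl
    rw [this, map_mul, Int.units_mul_self, TransvectionStruct.toMatrix,
      det_transvection_of_ne _ _ hij, map_one, Units.val_one]
  · intro A B hA hB hPA hPB e he
    obtain ⟨a, ha⟩ := exists_perm_mulVec hA
    obtain ⟨b, hb⟩ := exists_perm_mulVec hB
    have : e = a * b := by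
      ext1 v
      rw [he, Perm.mul_apply, ha, hb, mulVec_mulVec]
    rw [this, map_mul, Units.val_mul, hPA a ha, hPB b hb, det_mul, map_mul]

/-- A linear automorphism of a finite vector space over a field of odd order has sign the
quadratic character of its determinant. -/
theorem sign_linearEquiv (hF : ringChar F ≠ 2) {M : Type*} [AddCommGroup M] [Module F M]
    [Fintype M] [DecidableEq M] (e : M ≃ₗ[F] M) :
    ((Perm.sign e.toEquiv : ℤˣ) : ℤ) = quadraticChar F (LinearMap.det e.toLinearMap) := by
  classical
  let b := Module.finBasis F M
  have hdet := LinearMap.det_toMatrix b e.toLinearMap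
  have h0 : (LinearMap.toMatrix b b e.toLinearMap).det ≠ 0 := by
    rw [hdet]
    exact (LinearEquiv.isUnit_det' e).ne_zero
  rw [← hdet, ← sign_mulVec hF h0 (b.equivFun.toEquiv.permCongr e.toEquiv) fun v => ?_,
    Perm.sign_permCongr]
  obtain ⟨m, rfl⟩ := b.equivFun.surjective v
  have h1 := LinearMap.toMatrix_mulVec_repr b b e.toLinearMap m
  change b.equivFun (e (b.equivFun.symm (b.equivFun m))) = _
  rw [LinearEquiv.symm_apply_apply]
  exact h1.symm

end Zolotarev

/-! ### Half-systems and determinants on odd functions -/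

section HalfSystem

theorem IsHalf.prod_eq {Z R : Type*} [AddGroup Z] [Fintype Z] [DecidableEq Z]
    [CommMonoid R] {P : Set Z} [Fintype P]
    (hP : IsHalf P) (h : Z → R) : ∏ a, h a = h 0 * ∏ a : P, (h a * h (-a)) := by
  have e : (Finset.univ : Finset Z) =
      insert 0 (P.toFinset ∪ P.toFinset.image (fun a => -a)) := by
    ext a
    by_cases ha : a = 0
    · simp [ha]
    · have := (hP.2 a ha).1
      simp [ha, neg_eq_iff_eq_neg, this]
  have h0 : (0 : Z) ∉ P.toFinset ∪ P.toFinset.image (fun a => -a) := by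
    simp [hP.1]
  have hd : Disjoint P.toFinset (P.toFinset.image (fun a => -a)) := by
    rw [Finset.disjoint_left]
    intro a ha hb
    rw [Set.mem_toFinset] at ha
    obtain ⟨b, hb', rfl⟩ := Finset.mem_image.1 hb
    replace hb := Set.mem_toFinset.1 hb'
    have hb0 : b ≠ 0 := fun h => hP.1 (h ▸ hb)
    exact (hP.2 b hb0).2 ⟨hb, ha⟩
  rw [e, Finset.prod_insert h0, Finset.prod_union hd,
    Finset.prod_image (fun a _ b _ hab => neg_injective hab), ← Finset.prod_mul_distrib,
    Finset.prod_subtype P.toFinset (fun _ => Set.mem_toFinset) (fun a => h a * h (-a))]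

open Classical in
-- Any linear order, with no compatibility with addition, selects the smaller of `a` and `-a`.
theorem exists_isHalf (Z : Type*) [AddGroup Z] (hZ : ∀ a : Z, a ≠ 0 → a ≠ -a) :
    ∃ P : Set Z, IsHalf P := by
  let _ : LinearOrder Z := linearOrderOfSTO (WellOrderingRel (α := Z))
  refine ⟨{a | a < -a}, by simp, fun a ha => ⟨?_, ?_⟩⟩
  · simpa using lt_or_gt_of_ne (hZ a ha)
  · rintro ⟨h1, h2⟩
    simp only [Set.mem_ofPred_eq, neg_neg] at h1 h2
    exact lt_asymm h1 h2

/-- If `M` commutes with the reversal `a ↦ -a`, then the determinant of `M` on odd functions, taken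
in the basis given by a half-system, is that of `1 + (M - 1)(1 - J)/2`, where `J` is the matrix of
the reversal. -/
theorem IsHalf.det_odd_part {Z K : Type*} [AddGroup Z] [Fintype Z] [DecidableEq Z]
    [Field K] [CharZero K] {P : Set Z} [Fintype P] [DecidableEq P] (hP : IsHalf P) (M : Matrix Z Z K) (hM : ∀ a b, M (-a) b = M a (-b)) :
    (Matrix.of fun a b : P => M a b - M a (-b)).det =
      (1 + (M - 1) * ((2 : K)⁻¹ •
        (1 - Matrix.of fun a b : Z => if b = -a then (1 : K) else 0))).det := by
  -- The columns `δ_b - δ_{-b}` of `B` are a basis of the odd functions. Thus `B Bᵀ / 2` is the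
  -- projection `(1 - J)/2` onto them, and `Bᵀ B = 2`.
  let B : Matrix Z P K := Matrix.of fun x b => (if x = b then 1 else 0) - if x = -b then 1 else 0
  have hPneg : ∀ a : P, (-a : Z) ∉ P := fun a ha =>
    (hP.2 a (fun h => hP.1 (h ▸ a.2))).2 ⟨a.2, ha⟩
  have hBB : (2 : K)⁻¹ • (1 - Matrix.of fun a b : Z => if b = -a then (1 : K) else 0) =
      (2 : K)⁻¹ • (B * B.transpose) := by
    congr 1
    ext x y
    simp only [Matrix.sub_apply, Matrix.one_apply, Matrix.of_apply, Matrix.mul_apply,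
      Matrix.transpose_apply, B]
    by_cases hx : x = 0
    · subst hx
      have h1 : ∀ b : P, (0 : Z) ≠ b := fun b h => hP.1 (h ▸ b.2)
      have h2 : ∀ b : P, (0 : Z) ≠ -b := fun b h => h1 b (by simpa [eq_comm] using h)
      simp [h1, h2, eq_comm]
    · rcases (hP.2 x hx).1 with h | h
      · rw [Finset.sum_eq_single (⟨x, h⟩ : P)]
        · have : x ≠ -x := fun h' => hPneg ⟨x, h⟩ (h' ▸ h)
          simp [this, eq_comm]
        · intro b _ hb
          have h1 : x ≠ b := fun h' => hb (Subtype.ext h'.symm)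
          have h2 : x ≠ -b := fun h' => hPneg b (h' ▸ h)
          simp [h1, h2]
        · simp
      · rw [Finset.sum_eq_single (⟨-x, h⟩ : P)]
        · have : x ≠ -x := fun h' => hPneg ⟨-x, h⟩ (by simpa [← h'] using h)
          simp [this, eq_comm]
        · intro b _ hb
          have h1 : x ≠ b := fun h' => hPneg b (h' ▸ h)
          have h2 : x ≠ -b := fun h' => hb (Subtype.ext (by simp [h']))
          simp [h1, h2]
        · simp
  -- The identity `det (1 + XY) = det (1 + YX)` passes from size `Z` to size `P`, where the matrix
  -- becomes `1 + Bᵀ(M - 1)B/2 = BᵀMB/2`.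
  rw [hBB, ← Matrix.mul_smul, ← Matrix.mul_assoc, Matrix.det_one_add_mul_comm]
  congr 1
  have hB1 : B.transpose * B = (2 : K) • (1 : Matrix P P K) := by
    ext a b
    have e : ∀ x, B.transpose a x * B x b =
      (if x = a then B x b else 0) - (if x = -a then B x b else 0) := by
      intro x
      simp only [Matrix.transpose_apply, B, Matrix.of_apply]
      split_ifs <;> ring
    simp only [Matrix.mul_apply, e, Finset.sum_sub_distrib, Finset.sum_ite_eq', Finset.mem_univ,
      if_true, Matrix.smul_apply, Matrix.one_apply, smul_eq_mul]
    have h1 : (a : Z) ≠ -b := fun h' => hPneg b (h' ▸ a.2)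
    have h2 : (-a : Z) ≠ b := fun h' => hPneg a (h' ▸ b.2)
    by_cases hab : a = b
    · subst hab; simp [B, h1, h2]; norm_num
    · have : (a : Z) ≠ b := fun h => hab (Subtype.ext h)
      simp [B, h1, h2, hab, this]
  have hBM : (2 : K)⁻¹ • B.transpose * (M * B) = Matrix.of fun a b : P => M a b - M a (-b) := by
    ext a b
    have e1 : ∀ x, (M * B) x b = M x b - M x (-b) := by
      intro x
      simp [Matrix.mul_apply, B, mul_sub, Finset.sum_sub_distrib]
    have e2 : ∀ x, B.transpose a x * (M * B) x b =
      (if x = a then (M * B) x b else 0) - (if x = -a then (M * B) x b else 0) := by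
      intro x
      simp only [Matrix.transpose_apply, B, Matrix.of_apply]
      split_ifs <;> ring
    rw [Matrix.smul_mul, Matrix.smul_apply, Matrix.mul_apply, Finset.sum_congr rfl fun x _ => e2 x]
    simp only [Finset.sum_sub_distrib, Finset.sum_ite_eq', Finset.mem_univ,
      if_true, smul_eq_mul, e1, hM, neg_neg, Matrix.of_apply]
    ring
  rw [Matrix.sub_mul, Matrix.mul_sub, hBM, Matrix.one_mul, Matrix.smul_mul, hB1, smul_smul,
    inv_mul_cancel₀ two_ne_zero, one_smul, add_sub_cancel]

theorem det_monomial {Z K : Type*} [Fintype Z] [DecidableEq Z] [Field K] (σ : Equiv.Perm Z) (c : Z → K) :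
    (Matrix.of fun a b => if b = σ a then c a else 0).det =
      ((Equiv.Perm.sign σ : ℤˣ) : ℤ) * ∏ a, c a := by
  have : (Matrix.of fun a b => if b = σ a then c a else 0) =
      Matrix.diagonal c * σ.permMatrix K := by
    ext a b
    simp [Matrix.diagonal_mul, PEquiv.toMatrix_apply, Equiv.toPEquiv_apply, eq_comm]
  rw [this, Matrix.det_mul, Matrix.det_diagonal, Matrix.det_permutation, mul_comm]

/-- As `σ` commutes with negation, exactly one of `σ a`, `-σ a` lies in `P`, so the odd part `N` is
again monomial with entries `± c a`. In `N Nᵀ` the unknown signs and the permutation disappear. -/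
theorem IsHalf.det_odd_part_monomial_sq {Z K : Type*} [AddGroup Z] [DecidableEq Z]
    [Field K] {P : Set Z} [Fintype P] [DecidableEq P] (hP : IsHalf P) (σ : Equiv.Perm Z) (hσ : ∀ a, σ (-a) = -σ a) (c : Z → K)
    (M : Matrix Z Z K) (hM : ∀ a b, M a b = if b = σ a then c a else 0) :
    (Matrix.of fun a b : P => M a b - M a (-b)).det ^ 2 = ∏ a : P, c a ^ 2 := by
  have hP0 : ∀ a : P, (a : Z) ≠ 0 := fun a h => hP.1 (h ▸ a.2)
  have hPneg : ∀ a : P, (-a : Z) ∉ P := fun a ha => (hP.2 a (hP0 a)).2 ⟨a.2, ha⟩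
  set N : Matrix P P K := Matrix.of fun a b : P => M a b - M a (-b) with hN
  suffices h : N * N.transpose = Matrix.diagonal fun a : P => c a ^ 2 by
    rw [← Matrix.det_diagonal, ← h, Matrix.det_mul, Matrix.det_transpose, sq]
  have key : ∀ a d : P, N a d ≠ 0 → σ a = d ∨ σ a = -d := by
    intro a d h
    by_contra! hc
    refine h ?_
    simp [hN, hM, hc.1.symm, hc.2.symm]
  ext a b
  rw [Matrix.mul_apply]
  simp only [Matrix.transpose_apply]
  by_cases hab : a = b
  · subst hab
    rw [Matrix.diagonal_apply_eq]
    have hpm : ∀ d : P, (σ a = d → N a d = c a) ∧ (σ a = -d → N a d = -c a) := by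
      intro d
      have hd : (d : Z) ≠ -d := fun h => hPneg d (h ▸ d.2)
      constructor
      · intro h; simp [hN, hM, h, hd.symm]
      · intro h; simp [hN, hM, h, hd]
    -- If `σ a = 0`, then `σ (-a) = σ a`, so `-a = a` would lie in `P`.
    have hne : σ a ≠ 0 := by
      intro h
      have h1 := hσ a
      rw [h, neg_zero, ← h] at h1
      exact hPneg a (by rw [σ.injective h1]; exact a.2)
    rcases (hP.2 _ hne).1 with h | h
    · rw [Finset.sum_eq_single (⟨σ a, h⟩ : P), (hpm ⟨σ a, h⟩).1 rfl, sq]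
      · intro d _ hd
        by_contra h0
        rcases key a d (left_ne_zero_of_mul h0) with h1 | h1
        · exact hd (Subtype.ext h1.symm)
        · exact hPneg d (h1 ▸ h)
      · simp
    · rw [Finset.sum_eq_single (⟨-σ a, h⟩ : P), (hpm ⟨-σ a, h⟩).2 (by simp), neg_mul_neg, sq]
      · intro d _ hd
        by_contra h0
        rcases key a d (left_ne_zero_of_mul h0) with h1 | h1
        · exact hPneg d (h1 ▸ h)
        · exact hd (Subtype.ext (by simp [h1]))
      · simp
  · rw [Matrix.diagonal_apply_ne _ hab]
    refine Finset.sum_eq_zero fun d _ => ?_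
    by_contra h0
    have hne1 : σ a ≠ σ b := fun h => hab (Subtype.ext (σ.injective h))
    have hne2 : σ a ≠ -σ b := by
      rw [← hσ]
      exact fun h => hPneg b (by rw [← σ.injective h]; exact a.2)
    rcases key a d (left_ne_zero_of_mul h0) with h1 | h1 <;>
      rcases key b d (right_ne_zero_of_mul h0) with h2 | h2
    · exact hne1 (h1.trans h2.symm)
    · exact hne2 (by rw [h1, h2, neg_neg])
    · exact hne2 (by rw [h1, h2])
    · exact hne1 (h1.trans h2.symm)

end HalfSystem

open SympAlg

/-! ### The coefficients of `s(g)` -/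

section Spin

variable {p : ℕ} [Fact p.Prime] {F : Type*} [Field F] [Algebra (ZMod p) F]
  {V : Type*} [AddCommGroup V] [Module F V] [Fintype V] {φ : LinearMap.BilinForm F V}

/-- Compare the coefficients of `(x^g)` in `(x) s = s (x^g)`; on the right only the normalized
`(0)`-coefficient enters. -/
theorem IsSpin.coeff_sub (hφ : φ.IsAlt) {g : V ≃ₗ[F] V} {s : SympAlg p φ} (hs : IsSpin g s)
    (x : V) : s.coeff (g x - x) = fac p φ (g x) x := by
  have h := congrArg (fun a => a.coeff (g x)) (hs.2.2 x)
  simp only [coeff_of_mul, coeff_mul_of, sub_self, hs.2.1, fac_zero_left, mul_one] at h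
  rw [sub_eq_add_neg, fac_add_right, fac_neg_right, fac_self hφ, inv_one, mul_one,
    fac_swap hφ (g x) x, ← sub_eq_add_neg] at h
  exact (mul_inv_eq_one₀ (fac_ne_zero _ _)).1 h

/-- The support of `s(g)` is contained in `V^{g-1}`. -/
theorem IsSpin.mem_range_of_coeff_ne_zero [Finite F] (hp : p ≠ 2) (hφ : φ.IsAlt)
    (hφ' : φ.Nondegenerate) {g : V ≃ₗ[F] V} (hg : g ∈ Sp φ) {s : SympAlg p φ} (hs : IsSpin g s)
    {y : V} (hy : s.coeff y ≠ 0) : y ∈ LinearMap.range (g.toLinearMap - LinearMap.id) := by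
  set U := LinearMap.range (g.toLinearMap - LinearMap.id) with hU
  -- It suffices that `y` be orthogonal to every `z` in the orthogonal complement of `V^{g-1}`. Such
  -- a `z` is fixed by `g`, so `s` commutes with all `(t z)`.
  rw [← LinearMap.BilinForm.orthogonal_orthogonal hφ' hφ.isRefl U]
  intro z hz
  have hz' : ∀ x, φ (g x - x) z = 0 := fun x => hz _ ⟨x, rfl⟩
  have hfix : g z = z := by
    rw [← sub_eq_zero]
    refine hφ'.2 _ fun v => ?_
    obtain ⟨x, rfl⟩ := g.surjective v
    have h1 := hz' x
    have h2 : φ (g x) (g z) = φ x z := hg x z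
    rw [map_sub, LinearMap.sub_apply] at h1
    rw [map_sub, h2]
    linear_combination -h1
  by_contra hne
  obtain ⟨α, hα⟩ := exists_psi_ne_one (p := p) (F := F)
  have hne' : φ z y ≠ 0 := hne
  have h2 := two_ne_zero_of (F := F) hp
  -- Chosen so that `f(tz, y) / f(y, tz) = ψ(2tφ(z, y)) = ψ(α) ≠ 1`, whereas commutation of `s` with
  -- `(tz)` makes this ratio `1`.
  set t : F := α / (2 * φ z y)
  have h := congrArg (fun a => a.coeff (y + t • z)) (hs.2.2 (t • z))
  simp only [coeff_of_mul, coeff_mul_of, map_smul, hfix, add_sub_cancel_right] at h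
  have h3 := mul_left_cancel₀ hy h
  apply hα
  have h4 : α = φ (t • z) y - φ y (t • z) := by
    rw [← hφ.neg_eq (t • z) y]
    simp only [map_smul, LinearMap.smul_apply, smul_eq_mul, t]
    field_simp
    ring
  rw [h4, sub_eq_add_neg, AddChar.map_add_eq_mul, AddChar.map_neg_eq_inv]
  exact mul_inv_eq_one₀ (fac_ne_zero _ _) |>.2 h3

end Spin

/-! ### Matrix units, the determinant, and the reversal -/

section Units

variable {p : ℕ} [Fact p.Prime] {F : Type*} [Field F] [Algebra (ZMod p) F]
  {V : Type*} [AddCommGroup V] [Module F V] [Fintype V] {φ : LinearMap.BilinForm F V}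
  (D : Polarization φ)

omit [Fact p.Prime] [Algebra (ZMod p) F] in
theorem natCard_W_ne_zero : (Nat.card D.W : CycField p) ≠ 0 :=
  Nat.cast_ne_zero.2 Nat.card_pos.ne'

omit [Fintype V] in
theorem fac_eq_one_of_isLagrangian {W : Submodule F V} (hW : IsLagrangian φ W) {x y : V}
    (hx : x ∈ W) (hy : y ∈ W) : fac p φ x y = 1 := by
  rw [fac, hW.prop x hx y hy, AddChar.map_zero_eq_one]

theorem of_mul_of_of_isLagrangian {W : Submodule F V} (hW : IsLagrangian φ W) {x y : V}
    (hx : x ∈ W) (hy : y ∈ W) : of p φ x * of p φ y = of p φ (x + y) := by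
  rw [of_mul_of, fac_eq_one_of_isLagrangian hW hx hy, one_smul]

theorem of_mul_of_comm (hφ : φ.IsAlt) (x y : V) :
    of p φ x * of p φ y = (fac p φ x y) ^ 2 • (of p φ y * of p φ x) := by
  rw [of_mul_of, of_mul_of, smul_smul, add_comm y x, fac_swap hφ x y, sq, mul_assoc,
    mul_inv_cancel₀ (fac_ne_zero _ _), mul_one]

theorem e0_mul_of {w : V} (hw : w ∈ D.W) : e0 p D * of p φ w = e0 p D := by
  refine SympAlg.ext fun v => ?_
  rw [coeff_mul_of, coeff_e0, coeff_e0, D.W.sub_mem_iff_left hw]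
  split_ifs with h
  · rw [fac_eq_one_of_isLagrangian D.lagrangian_W (D.W.sub_mem h hw) hw, mul_one]
  · rw [zero_mul]

theorem of_mul_e0 {w : V} (hw : w ∈ D.W) : of p φ w * e0 p D = e0 p D := by
  refine SympAlg.ext fun v => ?_
  rw [coeff_of_mul, coeff_e0, coeff_e0, D.W.sub_mem_iff_left hw]
  split_ifs with h
  · rw [fac_eq_one_of_isLagrangian D.lagrangian_W hw (D.W.sub_mem h hw), mul_one]
  · rw [zero_mul]

theorem e0_mul_e0 : e0 p D * e0 p D = e0 p D := by
  classical
  nth_rewrite 2 [e0]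
  rw [mul_smul_comm, Finset.mul_sum, Finset.sum_congr rfl fun w _ => e0_mul_of D w.2,
    Finset.sum_const, Finset.card_univ, ← Nat.card_eq_fintype_card, ← Nat.cast_smul_eq_nsmul
    (CycField p), smul_smul, inv_mul_cancel₀ (natCard_W_ne_zero D), one_smul]

/-- For `w ∈ W`, both copies of `e₀` absorb `(w)`, while moving `(w)` past `(x)` costs `f(x, w)²`.
Some `w` makes this factor differ from `1`, since `W` separates the points of `W*`. -/
theorem e0_mul_of_mul_e0_of_ne_zero [Finite F] (hp : p ≠ 2) (hφ : φ.IsAlt)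
    (hφ' : φ.Nondegenerate) {x : V} (hx : x ∈ D.Wstar) (hx0 : x ≠ 0) :
    e0 p D * of p φ x * e0 p D = 0 := by
  obtain ⟨a, ha, hxa⟩ : ∃ a ∈ D.W, φ x a ≠ 0 := by
    by_contra! hc
    exact hx0 (eq_zero_of_pairing hφ' D.isCompl.symm D.lagrangian_Wstar hx hc)
  obtain ⟨α, hα⟩ := exists_psi_ne_one (p := p) (F := F)
  have h2 := two_ne_zero_of (F := F) hp
  set w : V := (α / (2 * φ x a)) • a with hw
  have hwW : w ∈ D.W := D.W.smul_mem _ ha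
  have hf : fac p φ x w ^ 2 = psi p α := by
    rw [sq, fac, ← AddChar.map_add_eq_mul, hw, map_smul, smul_eq_mul]
    congr 1
    field_simp
    ring
  have h : e0 p D * of p φ x * e0 p D = psi p α • (e0 p D * of p φ x * e0 p D) := by
    calc e0 p D * of p φ x * e0 p D = e0 p D * of p φ x * (of p φ w * e0 p D) := by
          rw [of_mul_e0 D hwW]
      _ = e0 p D * (of p φ x * of p φ w) * e0 p D := by simp only [mul_assoc]
      _ = psi p α • (e0 p D * (of p φ w * of p φ x) * e0 p D) := by
          rw [of_mul_of_comm hφ, hf, mul_smul_comm, smul_mul_assoc]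
      _ = psi p α • (e0 p D * of p φ x * e0 p D) := by
          rw [← mul_assoc (e0 p D), e0_mul_of D hwW]
  refine SympAlg.ext fun v => ?_
  have h3 := congrArg (fun b => b.coeff v) h
  simp only [coeff_smul] at h3
  by_contra h0
  exact hα (mul_right_cancel₀ h0 (h3.symm.trans (one_mul _).symm))

open Classical in
/-- The `e_{ab}` multiply like matrix units. -/
theorem matUnit_mul_matUnit [Finite F] (hp : p ≠ 2) (hφ : φ.IsAlt) (hφ' : φ.Nondegenerate)
    (a b c d : D.Wstar) :
    matUnit p D a b * matUnit p D c d = if b = c then matUnit p D a d else 0 := by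
  have h : matUnit p D a b * matUnit p D c d =
      of p φ (-a) * (e0 p D * of p φ (b - c) * e0 p D) * of p φ d := by
    rw [sub_eq_add_neg, ← of_mul_of_of_isLagrangian D.lagrangian_Wstar b.2 (D.Wstar.neg_mem c.2)]
    simp only [matUnit, mul_assoc]
  rw [h]
  split_ifs with hbc
  · rw [hbc, sub_self, ← one_def, mul_one, e0_mul_e0, matUnit]
  · rw [e0_mul_of_mul_e0_of_ne_zero D hp hφ hφ' (D.Wstar.sub_mem b.2 c.2), mul_zero, zero_mul]
    exact fun h => hbc (Subtype.ext (sub_eq_zero.1 h))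

open Classical in
theorem ofMatrix_apply (M : Matrix D.Wstar D.Wstar (CycField p)) :
    ofMatrix p D M = ∑ a, ∑ b, M a b • matUnit p D a b := rfl

open Classical in
theorem ofMatrix_mul [Finite F] (hp : p ≠ 2) (hφ : φ.IsAlt) (hφ' : φ.Nondegenerate)
    (M N : Matrix D.Wstar D.Wstar (CycField p)) :
    ofMatrix p D (M * N) = ofMatrix p D M * ofMatrix p D N := by
  simp only [ofMatrix_apply, Finset.sum_mul, Finset.mul_sum, smul_mul_smul_comm,
    matUnit_mul_matUnit D hp hφ hφ', Matrix.mul_apply, Finset.sum_smul, smul_ite, smul_zero]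
  rw [Finset.sum_comm]
  conv_rhs => rw [Finset.sum_comm]
  refine Finset.sum_congr rfl fun b _ => ?_
  conv_rhs => rw [Finset.sum_comm]
  refine Finset.sum_congr rfl fun a _ => ?_
  simp only [Finset.sum_ite_eq', Finset.mem_univ, if_true]

open Classical in
/-- The isomorphism of the symplectic algebra with a full matrix algebra. -/
noncomputable def matrixEquiv [Finite F] (hp : p ≠ 2) (hφ : φ.IsAlt) (hφ' : φ.Nondegenerate) :
    Matrix D.Wstar D.Wstar (CycField p) ≃ₐ[CycField p] SympAlg p φ :=
  AlgEquiv.ofLinearEquiv (LinearEquiv.ofBijective _ (ofMatrix_bijective p D hp hφ hφ'))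
    (by
      have h (a : SympAlg p φ) : ofMatrix p D 1 * a = a := by
        obtain ⟨M, rfl⟩ := (ofMatrix_bijective p D hp hφ hφ').2 a
        rw [← ofMatrix_mul D hp hφ hφ', one_mul]
      simpa using h 1)
    (ofMatrix_mul D hp hφ hφ')

theorem toMatrix_ofMatrix [Finite F] (hp : p ≠ 2) (hφ : φ.IsAlt) (hφ' : φ.Nondegenerate)
    (M : Matrix D.Wstar D.Wstar (CycField p)) : toMatrix p D (ofMatrix p D M) = M :=
  Function.leftInverse_invFun (ofMatrix_bijective p D hp hφ hφ').1 M

open Classical in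
theorem matrixEquiv_symm_apply [Finite F] (hp : p ≠ 2) (hφ : φ.IsAlt) (hφ' : φ.Nondegenerate)
    (a : SympAlg p φ) : (matrixEquiv D hp hφ hφ').symm a = toMatrix p D a := by
  rw [AlgEquiv.symm_apply_eq]
  exact (ofMatrix_toMatrix p D hp hφ hφ' a).symm

/-- Isomorphisms of an algebra with two full matrix algebras define the same determinant. -/
theorem det_algEquiv_eq {K A m n : Type*} [Field K] [Ring A] [Algebra K A] [Fintype m] [DecidableEq m]
    [Fintype n] [DecidableEq n] (e : A ≃ₐ[K] Matrix m m K) (f : A ≃ₐ[K] Matrix n n K) (a : A) : (e a).det = (f a).det := by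
  -- Skolem–Noether: an isomorphism of full endomorphism algebras is conjugation by a linear
  -- isomorphism `T`.
  obtain ⟨T, hT⟩ := AlgEquiv.eq_linearEquivConjAlgEquiv
    ((Matrix.toLinAlgEquiv'.symm.trans (e.symm.trans f)).trans Matrix.toLinAlgEquiv')
  have h := DFunLike.congr_fun hT (Matrix.toLinAlgEquiv' (e a))
  simp only [AlgEquiv.trans_apply, AlgEquiv.symm_apply_apply] at h
  have h2 := congrArg LinearMap.det h
  rw [LinearEquiv.conjAlgEquiv_apply, LinearMap.det_conj] at h2
  exact (LinearMap.det_toLin' (e a)).symm.trans (h2.symm.trans (LinearMap.det_toLin' (f a)))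

open Classical in
theorem det_toMatrix_eq [Finite F] (hp : p ≠ 2) (hφ : φ.IsAlt) (hφ' : φ.Nondegenerate)
    (D₁ D₂ : Polarization φ) (a : SympAlg p φ) :
    (toMatrix p D₁ a).det = (toMatrix p D₂ a).det := by
  rw [← matrixEquiv_symm_apply D₁ hp hφ hφ', ← matrixEquiv_symm_apply D₂ hp hφ hφ']
  exact det_algEquiv_eq _ _ a

/-- Makes the scalar `|W|⁻¹` in `j`, and so `j` itself, independent of the polarization. -/
theorem natCard_W_sq [Finite F] (hφ' : φ.Nondegenerate) : Nat.card D.W ^ 2 = Nat.card V := by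
  rw [← Nat.card_congr (Submodule.prodEquivOfIsCompl _ _ D.isCompl).toEquiv, Nat.card_prod,
    ← card_eq D hφ', sq]

open Classical in
/-- The matrix of `j = |W|⁻¹ ∑_v (v)` is that of the reversal `a ↦ -a`. -/
theorem ofMatrix_reversal (hp : p ≠ 2) (hφ : φ.IsAlt) :
    ofMatrix p D (Matrix.of fun a b => if b = -a then 1 else 0) =
      (Nat.card D.W : CycField p)⁻¹ • ∑ v, of p φ v := by
  refine SympAlg.ext fun v => ?_
  simp only [ofMatrix_apply, Matrix.of_apply, ite_smul, one_smul, zero_smul, Finset.sum_ite_eq',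
    Finset.mem_univ, if_true, coeff_sum, coeff_smul, coeff_matUnit, coeff_of, Finset.sum_ite_eq,
    mul_one]
  obtain ⟨w, hw, c, hc, rfl⟩ :=
    Submodule.mem_sup.1 (D.isCompl.sup_eq_top ▸ Submodule.mem_top (x := v))
  have h2 := two_ne_zero_of (F := F) hp
  -- Only `a = -c/2` contributes to the coefficient of `(w + c)`, and by `hf` it does so with
  -- trivial factor.
  have hmem : ∀ a : D.Wstar, w + c - ((-a : D.Wstar) : V) + a ∈ D.W ↔
      a = (-(2 : F)⁻¹) • (⟨c, hc⟩ : D.Wstar) := by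
    intro a
    have e : w + c - ((-a : D.Wstar) : V) + a = w + (c + (2 : F) • (a : V)) := by
      rw [two_smul, Submodule.coe_neg]; abel
    rw [e, D.W.add_mem_iff_right hw]
    constructor
    · intro h
      have h0 := (Submodule.disjoint_def.1 D.isCompl.disjoint) _ h
        (D.Wstar.add_mem hc (D.Wstar.smul_mem _ a.2))
      refine Subtype.ext ?_
      have h1 : c = -((2 : F) • (a : V)) := eq_neg_of_add_eq_zero_left h0
      simp [h1, smul_smul, h2]
    · rintro rfl
      simp [smul_smul, h2]
  have hf : ∀ a : D.Wstar, fac p φ (-(a : V)) (w + c - ((-a : D.Wstar) : V) + a) *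
      fac p φ (w + c - ((-a : D.Wstar) : V)) ((-a : D.Wstar) : V) = 1 := by
    intro a
    rw [fac, fac, ← AddChar.map_add_eq_mul, ← AddChar.map_zero_eq_one (psi p : AddChar F (CycField p))]
    congr 1
    simp only [Submodule.coe_neg, map_add, map_sub, map_neg, LinearMap.add_apply,
      LinearMap.sub_apply, LinearMap.neg_apply]
    linear_combination hφ.neg_eq w a + hφ.neg_eq c a - 3 * hφ.self_eq_zero (a : V)
  simp only [mul_assoc, hf, mul_one, coeff_e0, hmem]
  simp

/-- Conjugation by `s` merely permutes the summands. Hence the matrix of `s` commutes with the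
reversal, as `IsHalf.det_odd_part` requires. -/
theorem sum_of_mul_comm {g : V ≃ₗ[F] V} {s : SympAlg p φ} (hs : IsSpin g s) :
    (∑ v, of p φ v) * s = s * ∑ v, of p φ v := by
  rw [Finset.sum_mul, Finset.mul_sum, Finset.sum_congr rfl fun v _ => hs.2.2 v]
  exact Fintype.sum_equiv g.toEquiv _ _ fun v => rfl

end Units

/-! ### Invariance of `η` and its value on the stabilizer of `W` -/

section Eta

variable {p : ℕ} [Fact p.Prime] {F : Type*} [Field F] [Algebra (ZMod p) F]
  {V : Type*} [AddCommGroup V] [Module F V] [Fintype V] {φ : LinearMap.BilinForm F V}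
  (D : Polarization φ)

open Classical in
/-- For `s` intertwining the `(x)`, the determinant of `s^♭` is the determinant of an element of the
symplectic algebra that involves neither the half-system nor the polarization. -/
theorem det_flat [Finite F] (hp : p ≠ 2) (hφ : φ.IsAlt) (hφ' : φ.Nondegenerate)
    {P : Set D.Wstar} (hP : IsHalf P) {g : V ≃ₗ[F] V} {s : SympAlg p φ} (hs : IsSpin g s) :
    (flat p D P s).det = (toMatrix p D (1 + (s - 1) * ((2 : CycField p)⁻¹ •
      (1 - (Nat.card D.W : CycField p)⁻¹ • ∑ v, of p φ v)))).det := by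
  set R : Matrix D.Wstar D.Wstar (CycField p) := Matrix.of fun a b => if b = -a then 1 else 0
  set E := (matrixEquiv D hp hφ hφ').symm with hE
  have hR : E ((Nat.card D.W : CycField p)⁻¹ • ∑ v, of p φ v) = R := by
    rw [hE, matrixEquiv_symm_apply, ← ofMatrix_reversal D hp hφ, toMatrix_ofMatrix D hp hφ hφ']
  have hM : ∀ a b, E s (-a) b = E s a (-b) := by
    intro a b
    have h1 : R * E s = E s * R := by
      rw [← hR, ← map_mul, ← map_mul, smul_mul_assoc, mul_smul_comm, sum_of_mul_comm hs]
    have h2 := congrFun (congrFun h1 a) b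
    have h3 : ∀ x : D.Wstar, (b = -x) = (x = -b) := fun x => propext
      ⟨fun h => by rw [h, neg_neg], fun h => by rw [h, neg_neg]⟩
    simpa [R, Matrix.mul_apply, h3] using h2
  rw [← matrixEquiv_symm_apply D hp hφ hφ', ← hE, map_add, map_mul, map_sub, map_smul, map_sub,
    map_one, hR, ← hP.det_odd_part (E s) hM, hE, matrixEquiv_symm_apply]
  rfl

open Classical in
/-- `η(g)` does not depend on the polarization and the half-system. -/
theorem eta_eq_eta [Finite F] (hp : p ≠ 2) (hφ : φ.IsAlt) (hφ' : φ.Nondegenerate)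
    (D₁ D₂ : Polarization φ) {P₁ : Set D₁.Wstar} (hP₁ : IsHalf P₁) {P₂ : Set D₂.Wstar}
    (hP₂ : IsHalf P₂) (g : Sp φ) : eta p D₁ P₁ g = eta p D₂ P₂ g := by
  have hs := spin_spec (p := p) hp hφ hφ' g
  have hc : Nat.card D₁.W = Nat.card D₂.W := by
    refine Nat.pow_left_injective (n := 2) two_ne_zero ?_
    exact (natCard_W_sq D₁ hφ').trans (natCard_W_sq D₂ hφ').symm
  rw [eta, eta, det_flat D₁ hp hφ hφ' hP₁ hs, det_flat D₂ hp hφ hφ' hP₂ hs, hc,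
    det_toMatrix_eq hp hφ hφ' D₁ D₂, det_toMatrix_eq hp hφ hφ' D₁ D₂]

/-- The idempotent `e₀` is primitive. For `v = w + x` in `W ⊕ W*`, it absorbs `(w)`, and what
remains vanishes unless `x = 0`. -/
theorem exists_smul_e0 [Finite F] (hp : p ≠ 2) (hφ : φ.IsAlt) (hφ' : φ.Nondegenerate)
    (a : SympAlg p φ) : ∃ c : CycField p, e0 p D * a * e0 p D = c • e0 p D := by
  have h : ∀ v, ∃ c : CycField p, e0 p D * of p φ v * e0 p D = c • e0 p D := by
    intro v
    obtain ⟨w, hw, x, hx, rfl⟩ :=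
      Submodule.mem_sup.1 (D.isCompl.sup_eq_top ▸ Submodule.mem_top (x := v))
    have e : of p φ (w + x) = (fac p φ w x)⁻¹ • (of p φ w * of p φ x) := by
      rw [of_mul_of, smul_smul, inv_mul_cancel₀ (fac_ne_zero _ _), one_smul]
    rw [e, mul_smul_comm, smul_mul_assoc, ← mul_assoc, e0_mul_of D hw]
    by_cases hx0 : x = 0
    · exact ⟨(fac p φ w x)⁻¹, by rw [hx0, ← one_def, mul_one, e0_mul_e0]⟩
    · exact ⟨0, by rw [e0_mul_of_mul_e0_of_ne_zero D hp hφ hφ' hx hx0, smul_zero, zero_smul]⟩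
  choose c hc using h
  refine ⟨∑ v, a.coeff v * c v, ?_⟩
  conv_lhs => rw [eq_sum a]
  rw [Finset.mul_sum, Finset.sum_mul, Finset.sum_smul]
  refine Finset.sum_congr rfl fun v _ => ?_
  rw [mul_smul_comm, smul_mul_assoc, hc, smul_smul]

open Classical in
/-- If `g` stabilizes `W`, then `e₀ s(g)` is the multiple of `e₀` by the sum of the coefficients
of `s(g)` on `W`. -/
theorem IsSpin.e0_mul [Finite F] (hp : p ≠ 2) (hφ : φ.IsAlt) (hφ' : φ.Nondegenerate)
    {g : V ≃ₗ[F] V} (hg : D.W.map g.toLinearMap = D.W) {s : SympAlg p φ} (hs : IsSpin g s) :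
    e0 p D * s = (∑ w : D.W, s.coeff w) • e0 p D := by
  -- Conjugation by `s` permutes the elements `(w)`, `w ∈ W`, because `W^g = W`.
  have hcomm : e0 p D * s = s * e0 p D := by
    let gW : D.W ≃ D.W := (g.submoduleMap D.W).toEquiv.trans (Equiv.subtypeEquivRight fun v =>
      iff_of_eq (congrArg (v ∈ ·) hg))
    rw [e0, smul_mul_assoc, mul_smul_comm, Finset.sum_mul, Finset.mul_sum]
    congr 1
    exact Fintype.sum_equiv gW _ _ fun w => hs.2.2 w
  obtain ⟨c, hc⟩ := exists_smul_e0 D hp hφ hφ' s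
  have hc' : s * e0 p D = c • e0 p D := by
    rw [← hc, mul_assoc, ← hcomm, ← mul_assoc, e0_mul_e0, hcomm]
  rw [hcomm, hc']
  congr 1
  -- The `(0)`-coefficient of `s e₀ = c e₀` identifies the scalar: on the left it is `|W|⁻¹` times
  -- the coefficient sum over `W`.
  have h0 := congrArg (fun a => a.coeff 0) hc'
  simp only [coeff_mul, coeff_smul, coeff_e0, D.W.zero_mem, if_true, zero_sub, neg_mem_iff,
    fac_neg_right, fac_self hφ, inv_one, mul_one, mul_ite, mul_zero] at h0
  rw [← Finset.sum_filter, ← Finset.sum_mul] at h0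
  rw [← mul_right_cancel₀ (inv_ne_zero (natCard_W_ne_zero D)) h0]
  exact Finset.sum_subtype _ (by simp) _

theorem gStar_injective {g : Sp φ}
    (hg : D.W.map (g : V ≃ₗ[F] V).toLinearMap = D.W) : Function.Injective (gStar D g) := by
  rw [← LinearMap.ker_eq_bot, LinearMap.ker_eq_bot']
  intro a ha
  have h := gStar_spec D g a
  rw [ha, Submodule.coe_zero, sub_zero, ← hg] at h
  obtain ⟨w, hw, hwa⟩ := h
  have h1 : w = a := (g : V ≃ₗ[F] V).injective hwa
  exact Subtype.ext ((Submodule.disjoint_def.1 D.isCompl.disjoint) _ (h1 ▸ hw) a.2)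

open Classical in
/-- If `g` stabilizes `W`, then the matrix of `s(g)` is monomial. -/
theorem IsSpin.toMatrix_eq [Finite F] (hp : p ≠ 2) (hφ : φ.IsAlt) (hφ' : φ.Nondegenerate)
    {g : Sp φ} (hg : D.W.map (g : V ≃ₗ[F] V).toLinearMap = D.W) {s : SympAlg p φ}
    (hs : IsSpin (g : V ≃ₗ[F] V) s) :
    toMatrix p D s = Matrix.of fun a b => if b = gStar D g a then
      (∑ w : D.W, s.coeff w) * fac p φ (gStar D g a) ((g : V ≃ₗ[F] V) a) else 0 := by
  rw [← toMatrix_ofMatrix D hp hφ hφ' (Matrix.of fun a b => if b = gStar D g a then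
      (∑ w : D.W, s.coeff w) * fac p φ (gStar D g a) ((g : V ≃ₗ[F] V) a) else 0)]
  congr 1
  have h1 : (1 : SympAlg p φ) = ∑ a, matUnit p D a a := by
    rw [← map_one (matrixEquiv D hp hφ hφ')]
    change ofMatrix p D 1 = _
    simp [ofMatrix_apply, Matrix.one_apply]
  -- Each summand is `(-a) e₀ (a) s = (-a) e₀ s (a^g) = λ (-a) e₀ (a^g)`. Writing `a^g = w + b` with
  -- `b = a^{g*}`, the factor `(w)` is absorbed by `e₀`, leaving a multiple of `e_{ab}`.
  have h2 : s = ∑ a, matUnit p D a a * s := by rw [← Finset.sum_mul, ← h1, one_mul]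
  refine h2.trans ?_
  rw [ofMatrix_apply]
  refine Finset.sum_congr rfl fun a _ => ?_
  simp only [Matrix.of_apply, ite_smul, zero_smul, Finset.sum_ite_eq', Finset.mem_univ, if_true]
  have hw := gStar_spec D g a
  set b := gStar D g a
  set w := (g : V ≃ₗ[F] V) a - b with hwdef
  have hga : (g : V ≃ₗ[F] V) a = w + b := by rw [hwdef]; abel
  have e : of p φ ((g : V ≃ₗ[F] V) a) =
      fac p φ b ((g : V ≃ₗ[F] V) a) • (of p φ w * of p φ b) := by
    rw [of_mul_of, smul_smul, ← hga, fac_swap hφ ((g : V ≃ₗ[F] V) a) b]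
    conv_rhs => rw [hga, fac_add_left, fac_self hφ, mul_one, inv_mul_cancel₀ (fac_ne_zero _ _),
      one_smul]
    rw [hga]
  rw [matUnit, mul_assoc, hs.2.2, ← mul_assoc, mul_assoc (of p φ _), hs.e0_mul D hp hφ hφ' hg, e,
    matUnit, mul_smul_comm, mul_smul_comm, smul_mul_assoc, smul_smul, ← mul_assoc,
    mul_assoc (of p φ _) (e0 p D), e0_mul_of D hw, mul_comm (fac p φ _ _)]

open Classical in
-- The support of `s` lies in `V^{g-1}`, where `IsSpin.coeff_sub` gives the coefficients for any
-- choice of preimages `x`.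
theorem sum_coeff_eq_finsum [Finite F] (hp : p ≠ 2) (hφ : φ.IsAlt) (hφ' : φ.Nondegenerate)
    {g : V ≃ₗ[F] V} (hg : g ∈ Sp φ) {s : SympAlg p φ} (hs : IsSpin g s)
    (W : Submodule F V)
    (x : ↥(W ⊓ LinearMap.range (g.toLinearMap - LinearMap.id)) → V)
    (hx : ∀ y, g (x y) - x y = y) :
    ∑ w : W, s.coeff w = ∑ᶠ y, fac p φ (g (x y)) (x y) := by
  rw [finsum_eq_sum_of_fintype]
  have h : ∀ y, fac p φ (g (x y)) (x y) = s.coeff y := fun y => by rw [← hs.coeff_sub hφ, hx]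
  rw [Finset.sum_congr rfl fun y _ => h y,
    ← Finset.sum_subtype (Finset.univ.filter (· ∈ W)) (by simp) s.coeff,
    ← Finset.sum_subtype (Finset.univ.filter
      (· ∈ W ⊓ LinearMap.range (g.toLinearMap - LinearMap.id))) (by simp) s.coeff]
  refine (Finset.sum_subset (fun v hv => ?_) fun v hv hv' => ?_).symm
  · simp only [Finset.mem_filter, Finset.mem_univ, true_and] at hv ⊢
    exact hv.1
  · simp only [Finset.mem_filter, Finset.mem_univ, true_and] at hv hv'
    by_contra h0
    exact hv' ⟨hv, hs.mem_range_of_coeff_ne_zero hp hφ hφ' hg h0⟩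

open Classical in
-- Otherwise `e₀ s = 0` with `s` invertible, although `e₀ ≠ 0`.
theorem sum_coeff_ne_zero [Finite F] (hp : p ≠ 2) (hφ : φ.IsAlt) (hφ' : φ.Nondegenerate)
    {g : V ≃ₗ[F] V} (hg : D.W.map g.toLinearMap = D.W) {s : SympAlg p φ} (hs : IsSpin g s) :
    ∑ w : D.W, s.coeff w ≠ 0 := by
  intro h
  have h1 := hs.e0_mul D hp hφ hφ' hg
  rw [h, zero_smul] at h1
  have h2 := congrArg (fun a => a.coeff 0) (hs.1.mul_left_eq_zero.1 h1)
  simp only [coeff_e0, D.W.zero_mem, if_true, coeff_zero] at h2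
  exact inv_ne_zero (natCard_W_ne_zero D) h2

open Classical in
-- Both determinants come from the monomial matrix. Pairing `a` with `-a` turns `∏ c` into `λ ∏_P
-- c²`, and `∏_P c²` cancels against `(det s^♭)²`.
theorem eta_eq_of_map_eq [Fintype F] (hp : p ≠ 2) (hφ : φ.IsAlt) (hφ' : φ.Nondegenerate)
    {P : Set D.Wstar} (hP : IsHalf P) {g : Sp φ}
    (hg : D.W.map (g : V ≃ₗ[F] V).toLinearMap = D.W) :
    eta p D P g = ((quadraticChar F (LinearMap.det (gStar D g)) : ℤ) : CycField p) /
      ∑ w : D.W, (spin p g).coeff w := by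
  have hs := spin_spec (p := p) hp hφ hφ' g
  have hlam := sum_coeff_ne_zero D hp hφ hφ' hg hs
  have hM := hs.toMatrix_eq D hp hφ hφ' hg
  set lam := ∑ w : D.W, (spin p g).coeff w
  let σ : D.Wstar ≃ₗ[F] D.Wstar := LinearEquiv.ofInjectiveEndo _ (gStar_injective D hg)
  set c : D.Wstar → CycField p := fun a => lam * fac p φ (gStar D g a) ((g : V ≃ₗ[F] V) a) with hc
  have hc0 : c 0 = lam := by simp [hc, fac_zero_left]
  have hcneg : ∀ a, c (-a) = c a := by
    intro a
    simp only [hc, map_neg, Submodule.coe_neg, fac_neg_left, fac_neg_right, inv_inv]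
  have hcne : ∀ a, c a ≠ 0 := fun a => mul_ne_zero hlam (fac_ne_zero _ _)
  have h2F := two_ne_zero_of (F := F) hp
  have hF : ringChar F ≠ 2 := by
    intro h
    exact h2F (by simpa [h] using ringChar.Nat.cast_ringChar (R := F))
  have hdet : (toMatrix p D (spin p g)).det =
      ((quadraticChar F (LinearMap.det (gStar D g)) : ℤ) : CycField p) *
        (lam * ∏ a : P, c a ^ 2) := by
    have h1 := det_monomial σ.toEquiv c
    rw [sign_linearEquiv hF σ, hP.prod_eq c, hc0] at h1
    simp only [hcneg, ← sq] at h1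
    rw [hM]
    exact h1
  have hflat : (flat p D P (spin p g)).det ^ 2 = ∏ a : P, c a ^ 2 :=
    hP.det_odd_part_monomial_sq σ.toEquiv (fun a => map_neg σ a) c _ fun a b => by rw [hM]; rfl
  have hprod : ∏ a : P, c a ^ 2 ≠ 0 := Finset.prod_ne_zero_iff.2 fun a _ => pow_ne_zero _ (hcne a)
  rw [eta, hflat, hdet]
  have hdet0 : LinearMap.det (gStar D g) ≠ 0 := (LinearEquiv.isUnit_det' σ).ne_zero
  -- The character value is `±1`, its own inverse, so it may move from the denominator to the
  -- numerator.
  rcases quadraticChar_dichotomy hdet0 with h | h <;> rw [h] <;> push_cast <;> field_simp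

end Eta

end WeilRep

theorem mainTheorem7 (p : ℕ) [Fact p.Prime] (hp : p ≠ 2)
    {F : Type*} [Field F] [Fintype F] [DecidableEq F] [Algebra (ZMod p) F]
    {V : Type*} [AddCommGroup V] [Module F V] [Fintype V]
    (φ : LinearMap.BilinForm F V) (hφ : φ.IsAlt) (hφ' : φ.Nondegenerate)
    (D₀ : WeilRep.Polarization φ) (P₀ : Set D₀.Wstar) (hP₀ : WeilRep.IsHalf P₀)
    (D : WeilRep.Polarization φ) (g : WeilRep.Sp φ)
    (hg : D.W.map (g : V ≃ₗ[F] V).toLinearMap = D.W)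
    (x : ↥(D.W ⊓ LinearMap.range ((g : V ≃ₗ[F] V).toLinearMap - LinearMap.id)) → V)
    (hx : ∀ y, (g : V ≃ₗ[F] V) (x y) - x y = y) :
    (∑ᶠ y, WeilRep.fac p φ ((g : V ≃ₗ[F] V) (x y)) (x y)) ≠ 0 ∧
    WeilRep.eta p D₀ P₀ g =
      ((quadraticChar F (LinearMap.det (WeilRep.gStar D g)) : ℤ) : WeilRep.CycField p) /
        (∑ᶠ y, WeilRep.fac p φ ((g : V ≃ₗ[F] V) (x y)) (x y)) := by
  have hs := WeilRep.spin_spec (p := p) hp hφ hφ' g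
  -- A half-system exists for the adapted pair because `a = -a` forces `a = 0` in odd
  -- characteristic.
  obtain ⟨P, hP⟩ := WeilRep.exists_isHalf D.Wstar fun a ha h => ha <| by
    have h1 : (2 : F) • a = 0 := by rw [two_smul]; exact eq_neg_iff_add_eq_zero.1 h
    exact (smul_eq_zero.1 h1).resolve_left (WeilRep.two_ne_zero_of hp)
  rw [← WeilRep.sum_coeff_eq_finsum hp hφ hφ' g.2 hs D.W x hx]
  refine ⟨WeilRep.sum_coeff_ne_zero D hp hφ hφ' hg hs, ?_⟩
  rw [WeilRep.eta_eq_eta hp hφ hφ' D₀ D hP₀ hP, WeilRep.eta_eq_of_map_eq D hp hφ hφ' hP hg]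
  -- Only the choice of decidability instance in `quadraticChar` differs.
  congr!
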